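/- A \emph{link projection} $L$ is a regular projection of a link onto the sphere $S^2$: the image of a continuous map to $S^2$ from a disjoint union of finitely many circles, tamely immersed (for instance smoothly or polygonally), whose only multiple points are finitely many double points, at each of which two arcs intersect transversely. These double points are the \emph{crossings} of $L$. The \emph{regions} of $L$ are the connected components of $S^2 \setminus L$. Two regions are \emph{connected} if they share a crossing on their boundaries, and \emph{disconnected} otherwise. A set of regions is \emph{isolated} if any two distinct regions in it are disconnected, and the \emph{isolate-region number} $I(L)$ is the maximum cardinality of an isolated set of regions of $L$. \textbf{Corollary.} Every link projection $L$ with $4$ or more crossings satisfies $I(L) \geq 2$. -/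

import Mathlib

open Set Filter Topology

/-- The two-sphere, as the unit sphere of Euclidean three-space. -/
abbrev TwoSphere : Type := Metric.sphere (0 : EuclideanSpace ℝ (Fin 3)) 1

/-- A link projection on the two-sphere: the image of a disjoint union of finitely many circles
under a map whose only multiple points are finitely many double points, at each of which two arcs
intersect transversely. The arcs are tame, as for smooth or polygonal curves: near a point that is
passed once, the image is, up to a homeomorphism of a neighbourhood, a straight line, and near a
double point the two branches are two coordinate axes.
Every such map lifts to an embedding of the circles in `S² × ℝ`, and the regular projections of
(smooth or polygonal) links on the sphere are of this form. -/
structure LinkProjection where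
  /-- The number of circles. -/
  components : ℕ
  /-- The projection map, on the disjoint union of the circles. -/
  curve : C(Fin components × Circle, TwoSphere)
  /-- There are finitely many multiple points. -/
  finite_multiple : {p : TwoSphere | ∃ s t, s ≠ t ∧ curve s = p ∧ curve t = p}.Finite
  /-- No point is passed more than twice. -/
  fiber_le_two : ∀ p : TwoSphere, (curve ⁻¹' {p}).encard ≤ 2
  /-- Near a point that is passed only once, the image is a (topologically) straight arc. -/
  flat : ∀ s, (∀ t, curve t = curve s → t = s) →
    ∃ φ : OpenPartialHomeomorph TwoSphere (ℝ × ℝ), curve s ∈ φ.source ∧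
      ∀ q ∈ φ.source, q ∈ range curve ↔ (φ q).2 = 0
  /-- At a double point the two branches cross transversely: in a suitable chart centred there the
  image is the union of the two axes, the branch at `s` running in the first axis and the branch
  at `t` in the second. -/
  transverse : ∀ s t, s ≠ t → curve s = curve t →
    ∃ φ : OpenPartialHomeomorph TwoSphere (ℝ × ℝ), curve s ∈ φ.source ∧ φ (curve s) = 0 ∧
      (∀ q ∈ φ.source, q ∈ range curve ↔ (φ q).1 = 0 ∨ (φ q).2 = 0) ∧
      (∀ᶠ u in 𝓝 s, (φ (curve u)).2 = 0) ∧ (∀ᶠ u in 𝓝 t, (φ (curve u)).1 = 0)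

namespace LinkProjection

/-- The crossings of a link projection: its double points. -/
def crossings (L : LinkProjection) : Set TwoSphere :=
  {p | ∃ s t, s ≠ t ∧ L.curve s = p ∧ L.curve t = p}

/-- The regions of a link projection: the connected components of its complement. -/
def regions (L : LinkProjection) : Set (Set TwoSphere) :=
  {R | ∃ q ∈ (range L.curve)ᶜ, R = connectedComponentIn (range L.curve)ᶜ q}

/-- Two regions are connected when they share a crossing on their boundaries. -/
def RegionsConnected (L : LinkProjection) (R S : Set TwoSphere) : Prop :=
  ∃ c ∈ L.crossings, c ∈ frontier R ∧ c ∈ frontier S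

/-- A set of regions is isolated if any two distinct regions in it are disconnected, that is, not
connected. -/
def IsIsolated (L : LinkProjection) (W : Set (Set TwoSphere)) : Prop :=
  W ⊆ L.regions ∧ ∀ R ∈ W, ∀ S ∈ W, R ≠ S → ¬ L.RegionsConnected R S

/-- The isolate-region number: the maximal cardinality of an isolated set of regions. -/
noncomputable def isolateRegionNumber (L : LinkProjection) : ℕ∞ :=
  ⨆ W ∈ {W : Set (Set TwoSphere) | L.IsIsolated W}, W.encard

end LinkProjection

/-!
Suppose that any two distinct regions share a crossing, and let `n` be the number of crossings.
The proof colours regions and counts.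

Colourings. Removing from the circles the `2 n` points over the crossings cuts those circles that
contain such points into `2 n` arcs. Assign to every arc an element of `ZMod 2`, the jump across
it, such that around each crossing the four jumps sum to zero. Then some locally constant function
on the complement of the curve, that is, some function of the regions, has exactly these jumps.
Indeed such a function exists near every point of the sphere and is unique there up to a constant;
solutions over two open sets with a connected intersection can be glued (`Glued.union`), so there
is one over every rectangle of a planar chart, and the sphere is the union of a disc and a
neighbourhood of a point that meet in an annulus (`glued_univ_twoSphere`). This is the only global
property of the sphere that is used, and the charts in the definition of a link projection are what
makes the local problem solvable (`exists_locally_constant_with_jumps`).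

Counting. The conditions at the crossings sum to zero, since every arc has two ends. So they leave a
space of jumps of dimension at least `2 n - (n - 1) = n + 1`, and as constant colourings have no
jumps there are at least `n + 2` regions (`card_add_two_le_card_of_jumps`). This replaces Euler's
formula. With all jumps equal to `1` one gets a checkerboard colouring. In it only opposite corners
of a crossing have the same colour, so that the numbers `a`, `b` of regions of the two colours
satisfy `a (a - 1) ≤ 2 n` and `b (b - 1) ≤ 2 n`. Two regions of different colours that share a
crossing lie on the two sides of an arc, and this pair of sides is the same at both ends of the
arc, whence `a b ≤ 2 n`. Together with `a + b ≥ n + 2` this is impossible for `n ≥ 4`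
(`no_four_crossings_of_pairwise_connected`).
-/

/-! ### The combinatorial contradiction -/

/-- A dimension count over `ZMod 2`: if every choice of jumps satisfying the condition at every
crossing is realised by a two-colouring of `R`, then `R` has at least `card C + 2` elements.
The conditions at the crossings add up to `0`, because `P` is a permutation, so that at most
`card C - 1` of them are independent. -/
theorem card_add_two_le_card_of_jumps {C R : Type*} [Fintype C] [Fintype R] [Nonempty C]
    (P : C × Bool → C × Bool) (hP : Function.Injective P) (e₁ e₂ : C × Bool → R)
    (hcol : ∀ f : C × Bool → ZMod 2,
      (∀ c, f (c, false) + f (P (c, false)) + f (c, true) + f (P (c, true)) = 0) →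
      ∃ w : R → ZMod 2, ∀ d, w (e₁ d) + w (e₂ d) = f d) :
    Fintype.card C + 2 ≤ Fintype.card R := by
  classical
  let δ : (R → ZMod 2) →ₗ[ZMod 2] (C × Bool → ZMod 2) :=
    { toFun := fun w d => w (e₁ d) + w (e₂ d)
      map_add' := fun w w' => by ext d; simp only [Pi.add_apply]; ring
      map_smul' := fun a w => by
        ext d; simp only [Pi.smul_apply, smul_eq_mul, RingHom.id_apply]; ring }
  let κ : (C × Bool → ZMod 2) →ₗ[ZMod 2] (C → ZMod 2) :=
    { toFun := fun f c => f (c, false) + f (P (c, false)) + f (c, true) + f (P (c, true))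
      map_add' := fun w w' => by ext d; simp only [Pi.add_apply]; ring
      map_smul' := fun a w => by
        ext d; simp only [Pi.smul_apply, smul_eq_mul, RingHom.id_apply]; ring }
  let σ : (C → ZMod 2) →ₗ[ZMod 2] ZMod 2 :=
    { toFun := fun g => ∑ c, g c
      map_add' := fun w w' => by simp [Finset.sum_add_distrib]
      map_smul' := fun a w => by simp [Finset.mul_sum] }
  have h1 : LinearMap.ker κ ≤ LinearMap.range δ := by
    intro f hf
    obtain ⟨w, hw⟩ := hcol f (fun c => congrFun hf c)
    exact ⟨w, funext hw⟩
  have h2 : LinearMap.range κ ≤ LinearMap.ker σ := by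
    rintro _ ⟨f, rfl⟩
    have hbij : Function.Bijective P := Finite.injective_iff_bijective.1 hP
    have hs : ∑ d, f (P d) = ∑ d, f d := hbij.sum_comp f
    have e : ∀ g : C × Bool → ZMod 2, ∑ d, g d = ∑ c, (g (c, false) + g (c, true)) := by
      intro g
      rw [Fintype.sum_prod_type]
      exact Finset.sum_congr rfl fun c _ => by simp [add_comm]
    have : ∑ c, κ f c = ∑ d, f d + ∑ d, f (P d) := by
      rw [e f, e (fun d => f (P d)), ← Finset.sum_add_distrib]
      exact Finset.sum_congr rfl fun c _ => by
        change f (c, false) + f (P (c, false)) + f (c, true) + f (P (c, true)) = _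
        ring
    change ∑ c, κ f c = 0
    rw [this, hs, CharTwo.add_self_eq_zero]
  have h3 : LinearMap.range σ = ⊤ := by
    rw [LinearMap.range_eq_top]
    intro a
    obtain ⟨c⟩ := ‹Nonempty C›
    refine ⟨Pi.single c a, ?_⟩
    change ∑ c', (Pi.single c a : C → ZMod 2) c' = a
    simp
  have h4 : 1 ≤ Module.finrank (ZMod 2) (LinearMap.ker δ) := by
    rw [Nat.one_le_iff_ne_zero, Ne, Submodule.finrank_eq_zero, Submodule.eq_bot_iff]
    intro h
    have h5 := h (fun _ => 1) (by
      change (fun d => (1 : ZMod 2) + 1) = 0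
      ext; simp [CharTwo.add_self_eq_zero])
    obtain ⟨c⟩ := ‹Nonempty C›
    exact one_ne_zero (congrFun h5 (e₁ (c, true)))
  have d1 := LinearMap.finrank_range_add_finrank_ker δ
  have d2 := LinearMap.finrank_range_add_finrank_ker κ
  have d3 := LinearMap.finrank_range_add_finrank_ker σ
  have d4 := Submodule.finrank_mono h1
  have d5 := Submodule.finrank_mono h2
  rw [h3] at d3
  simp only [Module.finrank_fintype_fun_eq_card, Fintype.card_prod, Fintype.card_bool,
    finrank_top, Module.finrank_self] at d1 d2 d3
  omega

theorem two_mul_choose_two (a : ℕ) : 2 * a.choose 2 = a * (a - 1) := by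
  rw [Nat.choose_two_right, Nat.mul_div_cancel' (Nat.even_mul_pred_self a).two_dvd]

/-- If the elements of `A` are pairwise together at some index `c`, and at most two of them are
together at any given index, then there are at least as many indices as pairs. -/
theorem choose_two_le_card {C R : Type*} [Fintype C] [DecidableEq R] (A : Finset R)
    (x y : C → R) (h : ∀ R₁ ∈ A, ∀ R₂ ∈ A, R₁ ≠ R₂ → ∃ c, ({R₁, R₂} : Finset R) = {x c, y c}) :
    A.card.choose 2 ≤ Fintype.card C := by
  classical
  rw [← Finset.card_powersetCard]
  have : A.powersetCard 2 ⊆ Finset.univ.image fun c => ({x c, y c} : Finset R) := by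
    intro s hs
    obtain ⟨hsA, hs2⟩ := Finset.mem_powersetCard.1 hs
    obtain ⟨R₁, R₂, hne, rfl⟩ := Finset.card_eq_two.1 hs2
    obtain ⟨c, hc⟩ := h R₁ (hsA (by simp)) R₂ (hsA (by simp)) hne
    exact Finset.mem_image.2 ⟨c, Finset.mem_univ _, hc.symm⟩
  exact (Finset.card_le_card this).trans Finset.card_image_le

theorem zmod_two_cases (a : ZMod 2) : a = 0 ∨ a = 1 := by
  revert a; decide

/-- The counting argument. Here `C` stands for the crossings, `C × Bool` for the edges (each edge
is named after the crossing strand at which it starts, and `P` gives the edge that ends there),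
`R` for the regions, `r c a b` for the region in the corner `(a, b)` of the crossing `c`, and
`adj d` for the set of the one or two regions along the edge `d`. -/
theorem no_four_crossings_of_pairwise_connected {C R : Type*} [Fintype C] [Fintype R]
    (hC : 4 ≤ Fintype.card C) (P : C × Bool → C × Bool) (hP : Function.Injective P)
    (r : C → Bool → Bool → R) (adj : C × Bool → Set R)
    (h₁ : ∀ c, adj (c, false) = {r c true true, r c true false})
    (h₂ : ∀ c, adj (P (c, false)) = {r c false true, r c false false})
    (h₃ : ∀ c, adj (c, true) = {r c true true, r c false true})
    (h₄ : ∀ c, adj (P (c, true)) = {r c true false, r c false false})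
    (hcol : ∀ f : C × Bool → ZMod 2,
      (∀ c, f (c, false) + f (P (c, false)) + f (c, true) + f (P (c, true)) = 0) →
      ∃ w : R → ZMod 2, ∀ c,
        w (r c true true) + w (r c true false) = f (c, false) ∧
        w (r c false true) + w (r c false false) = f (P (c, false)) ∧
        w (r c true true) + w (r c false true) = f (c, true) ∧
        w (r c true false) + w (r c false false) = f (P (c, true)))
    (hshare : ∀ R₁ R₂ : R, R₁ ≠ R₂ → ∃ c a b a' b', R₁ = r c a b ∧ R₂ = r c a' b') : False := by
  classical
  have : Nonempty C := Fintype.card_pos_iff.1 (by omega)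
  have hF : Fintype.card C + 2 ≤ Fintype.card R := by
    refine card_add_two_le_card_of_jumps P hP (fun d => r d.1 true true)
      (fun d => if d.2 then r d.1 false true else r d.1 true false) fun f hf => ?_
    obtain ⟨w, hw⟩ := hcol f hf
    refine ⟨w, ?_⟩
    rintro ⟨c, _ | _⟩
    · simpa using (hw c).1
    · simpa using (hw c).2.2.1
  -- the checkerboard colouring: jumps equal to `1` across every edge
  obtain ⟨w, hw⟩ := hcol (fun _ => 1) (fun c => by decide)
  have key : ∀ x y : ZMod 2, x + y = 1 → y = x + 1 := by decide
  have w1 : ∀ c, w (r c true false) = w (r c true true) + 1 := fun c => key _ _ (hw c).1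
  have w2 : ∀ c, w (r c false true) = w (r c true true) + 1 := fun c => key _ _ (hw c).2.2.1
  have w3 : ∀ c, w (r c false false) = w (r c true true) := fun c => by
    have h := key _ _ (hw c).2.1
    rw [w2, add_assoc, CharTwo.add_self_eq_zero, add_zero] at h
    exact h
  have hne : ∀ x : ZMod 2, x + 1 ≠ x := by decide
  let A : ZMod 2 → Finset R := fun k => Finset.univ.filter fun S => w S = k
  have hA : ∀ k, (A k).card.choose 2 ≤ Fintype.card C := by
    intro k
    refine choose_two_le_card (A k)
      (fun c => if w (r c true true) = k then r c true true else r c true false)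
      (fun c => if w (r c true true) = k then r c false false else r c false true) ?_
    intro R₁ hR₁ R₂ hR₂ hR
    have k1 : w R₁ = k := (Finset.mem_filter.1 hR₁).2
    have k2 : w R₂ = k := (Finset.mem_filter.1 hR₂).2
    obtain ⟨c, a, b, a', b', rfl, rfl⟩ := hshare R₁ R₂ hR
    refine ⟨c, ?_⟩
    have e1 := w1 c
    have e2 := w2 c
    have e3 := w3 c
    have e4 := hne (w (r c true true))
    have e5 := hne k
    clear hcol hw w1 w2 w3 hne h₁ h₂ h₃ h₄ hshare hF key
    cases a <;> cases b <;> cases a' <;> cases b' <;>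
      simp_all [Finset.pair_comm]
  have hAB : (A 0).card * (A 1).card ≤ 2 * Fintype.card C := by
    rw [← Finset.card_product]
    have : (A 0 ×ˢ A 1).image (fun p => ({p.1, p.2} : Set R)) ⊆ Finset.univ.image adj := by
      intro s hs
      obtain ⟨⟨R₁, R₂⟩, hp, rfl⟩ := Finset.mem_image.1 hs
      obtain ⟨m1, m2⟩ := Finset.mem_product.1 hp
      have k1 : w R₁ = 0 := (Finset.mem_filter.1 m1).2
      have k2 : w R₂ = 1 := (Finset.mem_filter.1 m2).2
      have hR : R₁ ≠ R₂ := by rintro rfl; rw [k1] at k2; exact zero_ne_one k2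
      obtain ⟨c, a, b, a', b', rfl, rfl⟩ := hshare R₁ R₂ hR
      simp only [Finset.mem_image, Finset.mem_univ, true_and]
      have e3 := w3 c
      have e4 := (w1 c).trans (w2 c).symm
      have e6 : (0 : ZMod 2) ≠ 1 := by decide
      cases a <;> cases b <;> cases a' <;> cases b' <;>
        first
        | exact ⟨_, h₁ c⟩
        | exact ⟨_, h₂ c⟩
        | exact ⟨_, h₃ c⟩
        | exact ⟨_, h₄ c⟩
        | exact ⟨_, (h₁ c).trans (Set.pair_comm _ _)⟩
        | exact ⟨_, (h₂ c).trans (Set.pair_comm _ _)⟩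
        | exact ⟨_, (h₃ c).trans (Set.pair_comm _ _)⟩
        | exact ⟨_, (h₄ c).trans (Set.pair_comm _ _)⟩
        | exact absurd rfl hR
        | exact absurd (k1.symm.trans (e3.symm.trans k2)) e6
        | exact absurd (k1.symm.trans (e3.trans k2)) e6
        | exact absurd (k1.symm.trans (e4.trans k2)) e6
        | exact absurd (k1.symm.trans (e4.symm.trans k2)) e6
    rw [← Finset.card_image_of_injOn (f := fun p : R × R => ({p.1, p.2} : Set R))]
    · refine (Finset.card_le_card this).trans (Finset.card_image_le.trans ?_)
      simp [mul_comm]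
    · rintro ⟨x, y⟩ hxy ⟨x', y'⟩ hxy' h
      simp only [Finset.coe_product, Set.mem_prod, Finset.mem_coe, A, Finset.mem_filter,
        Finset.mem_univ, true_and] at hxy hxy'
      have h' : ({x, y} : Set R) = {x', y'} := h
      rcases Set.pair_eq_pair_iff.1 h' with ⟨rfl, rfl⟩ | ⟨rfl, rfl⟩
      · rfl
      · exact absurd (hxy.1.symm.trans hxy'.2) zero_ne_one
  have hsum : (A 0).card + (A 1).card = Fintype.card R := by
    rw [← Finset.card_union_of_disjoint, ← Finset.card_univ]
    · congr 1
      ext S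
      simp [A, zmod_two_cases]
    · rw [Finset.disjoint_left]
      intro S h0 h1
      exact zero_ne_one ((Finset.mem_filter.1 h0).2.symm.trans (Finset.mem_filter.1 h1).2)
  have c0 := two_mul_choose_two (A 0).card
  have c1 := two_mul_choose_two (A 1).card
  have a0 := hA 0
  have a1 := hA 1
  generalize (A 0).card = a at *
  generalize (A 1).card = b at *
  generalize Fintype.card C = n at *
  generalize Fintype.card R = F at *
  have ha : a * (a - 1) ≤ 2 * n := by omega
  have hb : b * (b - 1) ≤ 2 * n := by omega
  have hFn : n + 2 ≤ a + b := by omega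
  have ha' : a * a ≤ 2 * n + a := by
    rcases a with _ | a
    · simp
    · simp only [Nat.add_sub_cancel] at ha; nlinarith
  have hb' : b * b ≤ 2 * n + b := by
    rcases b with _ | b
    · simp
    · simp only [Nat.add_sub_cancel] at hb; nlinarith
  -- adding up, `(a + b) (a + b - 1) ≤ 8 n` with `a + b ≥ n + 2`, which forces `n = 4`
  have h5 : n ≤ 4 := by
    by_contra h
    push Not at h
    obtain ⟨k, hk⟩ := Nat.exists_eq_add_of_le hFn
    have : (a + b) * (a + b) ≤ 8 * n + (a + b) := by nlinarith
    rw [hk] at this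
    nlinarith
  obtain rfl : n = 4 := by omega
  have : a ≤ 3 := by by_contra h; push Not at h; nlinarith
  have : b ≤ 3 := by by_contra h; push Not at h; nlinarith
  obtain rfl : a = 3 := by omega
  obtain rfl : b = 3 := by omega
  omega

/-! ### Gluing two-valued functions with prescribed jumps -/

/-- On a preconnected set, a locally constant function is constant. -/
theorem IsPreconnected.eq_of_eventually_eq {X α : Type*} [TopologicalSpace X] {s : Set X}
    (hs : IsPreconnected s) {g : X → α} (hg : ∀ x ∈ s, ∀ᶠ y in 𝓝[s] x, g y = g x) {x y : X}
    (hx : x ∈ s) (hy : y ∈ s) : g x = g y :=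
  hs.induction₂ (fun a b => g a = g b) (fun a ha => (hg a ha).mono fun _ h => h.symm)
    (fun _ _ _ _ _ _ => Eq.trans) (fun _ _ _ _ => Eq.symm) hx hy

section Gluing

variable {Y : Type*} [TopologicalSpace Y]

/-- Near `x` and off `Γ`, the function `g` agrees up to an additive constant with `h`. -/
def AgreesNear (Γ : Set Y) (g h : Y → ZMod 2) (x : Y) : Prop :=
  ∃ k, ∀ᶠ q in 𝓝 x, q ∉ Γ → g q = h q + k

/-- Some function agrees with the local model `m x` near every point `x` of `U`. -/
def Glued (Γ : Set Y) (m : Y → Y → ZMod 2) (U : Set Y) : Prop :=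
  ∃ g : Y → ZMod 2, ∀ x ∈ U, AgreesNear Γ g (m x) x

variable {Γ : Set Y} {m : Y → Y → ZMod 2}

theorem Glued.mono {U V : Set Y} (h : Glued Γ m V) (hUV : U ⊆ V) : Glued Γ m U :=
  h.imp fun _ hg x hx => hg x (hUV hx)

theorem AgreesNear.sub {g h g' : Y → ZMod 2} {x : Y} (hg : AgreesNear Γ g h x)
    (hg' : AgreesNear Γ g' h x) : AgreesNear Γ g g' x := by
  obtain ⟨k, hk⟩ := hg
  obtain ⟨k', hk'⟩ := hg'
  refine ⟨k - k', ?_⟩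
  filter_upwards [hk, hk'] with q h1 h2 hq
  rw [h1 hq, h2 hq]; ring

theorem AgreesNear.congr {g h g' : Y → ZMod 2} {x : Y} (hg : AgreesNear Γ g h x)
    (hg' : AgreesNear Γ g' g x) : AgreesNear Γ g' h x := by
  obtain ⟨k, hk⟩ := hg
  obtain ⟨k', hk'⟩ := hg'
  refine ⟨k + k', ?_⟩
  filter_upwards [hk, hk'] with q h1 h2 hq
  rw [h2 hq, h1 hq]; ring

/-- Over two open sets with a preconnected intersection, solutions can be glued: their difference
is constant on the intersection. -/
theorem Glued.union (hΓ : Dense Γᶜ) {U V : Set Y} (hU : IsOpen U) (hV : IsOpen V)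
    (hUV : IsPreconnected (U ∩ V)) (gU : Glued Γ m U) (gV : Glued Γ m V) :
    Glued Γ m (U ∪ V) := by
  classical
  obtain ⟨g₁, h₁⟩ := gU
  obtain ⟨g₂, h₂⟩ := gV
  have hk : ∀ x, ∃ k, x ∈ U ∩ V → ∀ᶠ q in 𝓝 x, q ∉ Γ → g₁ q = g₂ q + k := by
    intro x
    by_cases hx : x ∈ U ∩ V
    · obtain ⟨k, hk⟩ := (h₁ x hx.1).sub (h₂ x hx.2)
      exact ⟨k, fun _ => hk⟩
    · exact ⟨0, fun h => absurd h hx⟩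
  choose κ hκ using hk
  have hκc : ∀ x ∈ U ∩ V, ∀ᶠ y in 𝓝[U ∩ V] x, κ y = κ x := by
    intro x hx
    filter_upwards [self_mem_nhdsWithin,
      nhdsWithin_le_nhds (hκ x hx).eventually_nhds] with y hy hyx
    have := hΓ.inter_nhds_nonempty (hyx.and (hκ y hy))
    obtain ⟨q, hq, hq1, hq2⟩ := this
    exact add_left_cancel ((hq2 hq).symm.trans (hq1 hq))
  obtain ⟨k, hk⟩ : ∃ k, ∀ x ∈ U ∩ V, κ x = k := by
    rcases (U ∩ V).eq_empty_or_nonempty with h | ⟨y, hy⟩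
    · exact ⟨0, fun x hx => by simp [h] at hx⟩
    · exact ⟨κ y, fun x hx => hUV.eq_of_eventually_eq hκc hx hy⟩
  refine ⟨fun q => if q ∈ U then g₁ q else g₂ q + k, ?_⟩
  rintro x (hx | hx)
  · refine (h₁ x hx).congr ⟨0, ?_⟩
    filter_upwards [hU.mem_nhds hx] with q hq _
    simp [hq]
  · refine (h₂ x hx).congr ⟨k, ?_⟩
    filter_upwards [hV.mem_nhds hx] with q hq hqΓ
    split_ifs with hqU
    · rw [← hk q ⟨hqU, hq⟩]
      exact (hκ q ⟨hqU, hq⟩).self_of_nhds hqΓ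
    · rfl

/-- If the local models are compatible, then each of them solves the problem near its point. -/
theorem exists_open_glued (hm : ∀ x, ∀ᶠ y in 𝓝 x, AgreesNear Γ (m x) (m y) y) (x : Y) :
    ∃ U, IsOpen U ∧ x ∈ U ∧ Glued Γ m U := by
  obtain ⟨U, hU, hUo, hx⟩ := eventually_nhds_iff.1 (hm x)
  exact ⟨U, hUo, hx, m x, hU⟩

end Gluing

/-- An induction principle on the line: a property of sets which passes to subsets, holds near
every point and passes to unions of two overlapping open intervals holds for compact intervals. -/
theorem real_interval_induction {Q : Set ℝ → Prop} (hmono : ∀ U V, U ⊆ V → Q V → Q U)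
    (hloc : ∀ x, ∃ U ∈ 𝓝 x, Q U)
    (hglue : ∀ U V, IsOpen U → IsOpen V → IsPreconnected U → IsPreconnected V →
      Q U → Q V → Q (U ∪ V)) (a b : ℝ) : Q (Icc a b) := by
  have key : ∃ U, IsOpen U ∧ IsPreconnected U ∧ a ∈ U ∧ b ∈ U ∧ Q U := by
    refine isPreconnected_univ.induction₂
      (fun a b => ∃ U, IsOpen U ∧ IsPreconnected U ∧ a ∈ U ∧ b ∈ U ∧ Q U) ?_ ?_ ?_
      (mem_univ a) (mem_univ b)
    · intro x _
      obtain ⟨U, hU, hQ⟩ := hloc x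
      obtain ⟨ε, hε, hεU⟩ := Metric.mem_nhds_iff.1 hU
      rw [nhdsWithin_univ]
      filter_upwards [Metric.ball_mem_nhds x hε] with y hy
      exact ⟨_, Metric.isOpen_ball, (convex_ball x ε).isPreconnected, Metric.mem_ball_self hε, hy,
        hmono _ _ hεU hQ⟩
    · rintro x y z _ _ _ ⟨U, hU, hU', hx, hy, hQ⟩ ⟨V, hV, hV', hy', hz, hQ'⟩
      exact ⟨U ∪ V, hU.union hV, hU'.union y hy hy' hV', Or.inl hx, Or.inr hz,
        hglue _ _ hU hV hU' hV' hQ hQ'⟩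
    · rintro x y _ _ ⟨U, hU, hU', hx, hy, hQ⟩
      exact ⟨U, hU, hU', hy, hx, hQ⟩
  obtain ⟨U, -, hU, ha, hb, hQ⟩ := key
  exact hmono _ _ (hU.Icc_subset ha hb) hQ

/-- Compatible local models can be glued over every rectangle of a planar chart. -/
theorem glued_symm_image_rectangle {Y : Type*} [TopologicalSpace Y] {Γ : Set Y}
    {m : Y → Y → ZMod 2} (hΓ : Dense Γᶜ)
    (hm : ∀ x, ∀ᶠ y in 𝓝 x, AgreesNear Γ (m x) (m y) y)
    (e : OpenPartialHomeomorph Y (ℝ × ℝ)) (he : e.target = univ) (a b c d : ℝ) :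
    Glued Γ m (e.symm '' (Icc a b ×ˢ Icc c d)) := by
  have hopen : ∀ s : Set (ℝ × ℝ), IsOpen s → IsOpen (e.symm '' s) := fun s hs =>
    e.symm.isOpen_image_of_subset_source hs (by simp [he])
  have hconn : ∀ s : Set (ℝ × ℝ), IsPreconnected s → IsPreconnected (e.symm '' s) := fun s hs =>
    hs.image _ (e.continuousOn_symm.mono (by simp [he]))
  have hinj : InjOn e.symm univ := by
    have := e.symm.injOn
    rwa [e.symm_source, he] at this
  have hint : ∀ s t : Set (ℝ × ℝ), e.symm '' s ∩ e.symm '' t = e.symm '' (s ∩ t) := fun s t =>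
    (hinj.image_inter (subset_univ s) (subset_univ t)).symm
  have hpre : ∀ U V : Set ℝ, IsPreconnected U → IsPreconnected V → IsPreconnected (U ∩ V) :=
    fun U V hU hV => (hU.ordConnected.inter hV.ordConnected).isPreconnected
  -- first thin vertical strips, then their union
  have step : ∀ c d x : ℝ, ∃ δ > 0, Glued Γ m (e.symm '' (Metric.ball x δ ×ˢ Icc c d)) := by
    intro c d x
    refine real_interval_induction
      (Q := fun U => ∃ δ > 0, Glued Γ m (e.symm '' (Metric.ball x δ ×ˢ U))) ?_ ?_ ?_ c d
    · rintro U V hUV ⟨δ, hδ, h⟩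
      exact ⟨δ, hδ, h.mono (image_mono (prod_mono_right hUV))⟩
    · intro y
      obtain ⟨W, hW, hxW, hQ⟩ := exists_open_glued hm (e.symm (x, y))
      have : e.symm ⁻¹' W ∈ 𝓝 (x, y) :=
        (e.continuousAt_symm (by simp [he])).preimage_mem_nhds (hW.mem_nhds hxW)
      obtain ⟨δ, hδ, h⟩ := Metric.mem_nhds_iff.1 this
      rw [← ball_prod_same] at h
      exact ⟨_, Metric.ball_mem_nhds y hδ, δ, hδ, hQ.mono (image_subset_iff.2 h)⟩
    · rintro U V hU hV hU' hV' ⟨δ, hδ, h⟩ ⟨δ', hδ', h'⟩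
      refine ⟨min δ δ', lt_min hδ hδ', ?_⟩
      rw [prod_union, image_union]
      refine Glued.union hΓ (hopen _ (Metric.isOpen_ball.prod hU))
        (hopen _ (Metric.isOpen_ball.prod hV)) ?_
        (h.mono (image_mono (prod_mono_left (Metric.ball_subset_ball (min_le_left _ _)))))
        (h'.mono (image_mono (prod_mono_left (Metric.ball_subset_ball (min_le_right _ _)))))
      rw [hint, ← prod_inter]
      exact hconn _ ((convex_ball _ _).isPreconnected.prod (hpre _ _ hU' hV'))
  refine (real_interval_induction
      (Q := fun U => Glued Γ m (e.symm '' (U ×ˢ Ioo (c - 1) (d + 1)))) ?_ ?_ ?_ a b).mono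
      (image_mono (prod_mono_right fun y hy => ⟨by linarith [hy.1], by linarith [hy.2]⟩))
  · intro U V hUV h
    exact h.mono (image_mono (prod_mono_left hUV))
  · intro x
    obtain ⟨δ, hδ, h⟩ := step (c - 1) (d + 1) x
    exact ⟨_, Metric.ball_mem_nhds x hδ, h.mono (image_mono (prod_mono_right Ioo_subset_Icc_self))⟩
  · intro U V hU hV hU' hV' h h'
    rw [union_prod, image_union]
    refine Glued.union hΓ (hopen _ (hU.prod isOpen_Ioo)) (hopen _ (hV.prod isOpen_Ioo)) ?_ h h'
    rw [hint, ← inter_prod]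
    exact hconn _ ((hpre _ _ hU' hV').prod isPreconnected_Ioo)

/-- Stereographic projection onto `ℝ × ℝ`. -/
theorem exists_stereographic_chart (v : TwoSphere) :
    ∃ e : OpenPartialHomeomorph TwoSphere (ℝ × ℝ), e.source = {v}ᶜ ∧ e.target = univ := by
  have : Fact (Module.finrank ℝ (EuclideanSpace ℝ (Fin 3)) = 2 + 1) :=
    ⟨finrank_euclideanSpace_fin⟩
  refine ⟨(stereographic' 2 v).transHomeomorph
    ((EuclideanSpace.equiv (Fin 2) ℝ).toHomeomorph.trans (Homeomorph.finTwoArrow)), ?_, ?_⟩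
  · simp
  · simp

/-- Open annuli of the plane are connected. -/
theorem isPreconnected_annulus {r R : ℝ} (hr : 0 ≤ r) :
    IsPreconnected {p : ℝ × ℝ | r < ‖p‖ ∧ ‖p‖ < R} := by
  have hrank : 1 < Module.rank ℝ (ℝ × ℝ) := by
    rw [← Module.finrank_eq_rank, Module.finrank_prod, Module.finrank_self]
    norm_num
  have h : IsPreconnected ((fun x : ℝ × (ℝ × ℝ) => x.1 • x.2) ''
      (Ioo r R ×ˢ Metric.sphere (0 : ℝ × ℝ) 1)) :=
    (isPreconnected_Ioo.prod (isPreconnected_sphere hrank 0 1)).image _ (by fun_prop)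
  convert! h using 1
  ext p
  constructor
  · rintro ⟨h1, h2⟩
    have hp : 0 < ‖p‖ := hr.trans_lt h1
    refine ⟨(‖p‖, ‖p‖⁻¹ • p), ⟨⟨h1, h2⟩, ?_⟩, ?_⟩
    · rw [mem_sphere_zero_iff_norm, norm_smul, norm_inv, norm_norm, inv_mul_cancel₀ hp.ne']
    · simp [smul_smul, mul_inv_cancel₀ hp.ne']
  · rintro ⟨⟨t, q⟩, ⟨⟨h1, h2⟩, hq⟩, rfl⟩
    have hq1 : ‖q‖ = 1 := mem_sphere_zero_iff_norm.1 hq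
    have ht : |t| = t := abs_of_nonneg (hr.trans h1.le)
    change r < ‖t • q‖ ∧ ‖t • q‖ < R
    rw [norm_smul, hq1, mul_one, Real.norm_eq_abs, ht]
    exact ⟨h1, h2⟩

/-- On the sphere, compatible local models can always be glued; this is the vanishing of
`H¹(S²; ℤ/2)`. The sphere is covered by a large disc in a stereographic chart and a neighbourhood
of the centre of projection, which meet in an annulus. -/
theorem glued_univ_twoSphere {Γ : Set TwoSphere} {m : TwoSphere → TwoSphere → ZMod 2}
    (hΓ : Dense Γᶜ) (hm : ∀ x, ∀ᶠ y in 𝓝 x, AgreesNear Γ (m x) (m y) y) :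
    Glued Γ m univ := by
  let v : TwoSphere := ⟨EuclideanSpace.single 0 1, by simp⟩
  obtain ⟨e, hes, het⟩ := exists_stereographic_chart v
  obtain ⟨W, hW, hvW, hQ⟩ := exists_open_glued hm v
  have hopen : ∀ s : Set (ℝ × ℝ), IsOpen s → IsOpen (e.symm '' s) := fun s hs =>
    e.symm.isOpen_image_of_subset_source hs (by simp [het])
  have hK : IsCompact (e '' Wᶜ) := by
    refine hW.isClosed_compl.isCompact.image_of_continuousOn (e.continuousOn.mono ?_)
    rw [hes]
    exact fun x hx hxv => hx (by rw [mem_singleton_iff.1 hxv]; exact hvW)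
  obtain ⟨r, hr⟩ := hK.isBounded.subset_closedBall 0
  set ρ := max r 0
  have hρ : ∀ x ∉ W, ‖e x‖ ≤ ρ := fun x hx =>
    (mem_closedBall_zero_iff.1 (hr (mem_image_of_mem e hx))).trans (le_max_left _ _)
  have hsrc : ∀ x, x ≠ v → e.symm (e x) = x := fun x hx => e.left_inv (by rw [hes]; exact hx)
  have htgt : ∀ p, e (e.symm p) = p := fun p => e.right_inv (by rw [het]; trivial)
  have hsv : ∀ p, e.symm p ≠ v := fun p => by
    have : e.symm p ∈ e.source := e.map_target (by rw [het]; trivial)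
    rw [hes] at this
    exact this
  -- the part of `W` outside the closed disc of radius `ρ`
  let V : Set TwoSphere := W ∩ (e.symm '' Metric.closedBall 0 ρ)ᶜ
  have hV : IsOpen V := by
    refine hW.inter (IsCompact.isClosed ?_).isOpen_compl
    exact (isCompact_closedBall _ _).image_of_continuousOn (e.continuousOn_symm.mono (by simp [het]))
  have hU : Glued Γ m (e.symm '' Metric.ball 0 (ρ + 1)) := by
    refine (glued_symm_image_rectangle hΓ hm e het (-(ρ + 1)) (ρ + 1) (-(ρ + 1)) (ρ + 1)).mono
      (image_mono ?_)
    intro p hp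
    have hp' := (mem_ball_zero_iff.1 hp).le
    have h1 := abs_le.1 ((norm_fst_le p).trans hp')
    have h2 := abs_le.1 ((norm_snd_le p).trans hp')
    exact ⟨h1, h2⟩
  refine (Glued.union hΓ (hopen _ Metric.isOpen_ball) hV ?_ hU (hQ.mono inter_subset_left)).mono ?_
  · convert! (isPreconnected_annulus (R := ρ + 1) (le_max_right r 0)).image e.symm
      (e.continuousOn_symm.mono (by simp [het])) using 1
    ext x
    constructor
    · rintro ⟨⟨p, hp, rfl⟩, -, h⟩
      refine ⟨p, ⟨?_, mem_ball_zero_iff.1 hp⟩, rfl⟩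
      by_contra hlt
      exact h ⟨p, mem_closedBall_zero_iff.2 (not_lt.1 hlt), rfl⟩
    · rintro ⟨p, ⟨h1, h2⟩, rfl⟩
      refine ⟨⟨p, mem_ball_zero_iff.2 h2, rfl⟩, ?_, ?_⟩
      · by_contra hn
        have := hρ _ hn
        rw [htgt] at this
        exact absurd h1 (not_lt.2 this)
      · rintro ⟨q, hq, hqp⟩
        have : q = p := by rw [← htgt q, hqp, htgt]
        rw [this] at hq
        exact absurd h1 (not_lt.2 (mem_closedBall_zero_iff.1 hq))
  · intro x _
    by_cases hx : x ∈ W ∧ x ∉ e.symm '' Metric.closedBall 0 ρ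
    · exact Or.inr hx
    · left
      have hp : ∃ p ∈ Metric.closedBall (0 : ℝ × ℝ) ρ, e.symm p = x := by
        by_cases hxW : x ∈ W
        · by_contra h
          exact hx ⟨hxW, h⟩
        · have hxv : x ≠ v := fun h => hxW (h ▸ hvW)
          exact ⟨e x, mem_closedBall_zero_iff.2 (hρ x hxW), hsrc x hxv⟩
      obtain ⟨p, hp, rfl⟩ := hp
      exact ⟨p, Metric.closedBall_subset_ball (by linarith) hp, rfl⟩

/-! ### Charts of a curve in a surface -/

section Charts

variable {Y : Type*} [TopologicalSpace Y] {Γ : Set Y}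

/-- A point in the domain of a planar chart has small neighbourhoods that look like squares in the
chart; these meet the preimage of every convex set in a preconnected set. -/
theorem exists_chart_box (φ : OpenPartialHomeomorph Y (ℝ × ℝ)) {y : Y} (hy : y ∈ φ.source)
    {N : Set Y} (hN : N ∈ 𝓝 y) :
    ∃ V, IsOpen V ∧ y ∈ V ∧ V ⊆ N ∧ V ⊆ φ.source ∧
      ∀ K : Set (ℝ × ℝ), Convex ℝ K → IsPreconnected (V ∩ φ ⁻¹' K) := by
  have h1 : φ.symm ⁻¹' N ∈ 𝓝 (φ y) :=
    (φ.continuousAt_symm (φ.map_source hy)).preimage_mem_nhds (by rwa [φ.left_inv hy])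
  have h2 : φ.target ∈ 𝓝 (φ y) := φ.open_target.mem_nhds (φ.map_source hy)
  obtain ⟨ε, hε, hB⟩ := Metric.mem_nhds_iff.1 (inter_mem h1 h2)
  refine ⟨φ.source ∩ φ ⁻¹' Metric.ball (φ y) ε, φ.isOpen_inter_preimage Metric.isOpen_ball,
    ⟨hy, Metric.mem_ball_self hε⟩, ?_, inter_subset_left, ?_⟩
  · rintro q ⟨hq, hqB⟩
    have := (hB hqB).1
    rwa [mem_preimage, φ.left_inv hq] at this
  · intro K hK
    have : φ.source ∩ φ ⁻¹' Metric.ball (φ y) ε ∩ φ ⁻¹' K =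
        φ.symm '' (Metric.ball (φ y) ε ∩ K) := by
      rw [φ.symm_image_eq_source_inter_preimage (inter_subset_left.trans fun p hp => (hB hp).2),
        inter_assoc, preimage_inter]
    rw [this]
    refine ((convex_ball _ _).inter hK).isPreconnected.image _ (φ.continuousOn_symm.mono ?_)
    exact inter_subset_left.trans fun p hp => (hB hp).2

theorem mem_closure_inter_chart_preimage (φ : OpenPartialHomeomorph Y (ℝ × ℝ)) {q : Y}
    (hq : q ∈ φ.source) {V : Set Y} (hV : V ∈ 𝓝 q) {K : Set (ℝ × ℝ)} (h : φ q ∈ closure K) :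
    q ∈ closure (V ∩ φ ⁻¹' K) := by
  rw [mem_closure_iff_nhds] at h ⊢
  intro N hN
  have h1 : φ.symm ⁻¹' (N ∩ V) ∈ 𝓝 (φ q) :=
    (φ.continuousAt_symm (φ.map_source hq)).preimage_mem_nhds
      (by rw [φ.left_inv hq]; exact inter_mem hN hV)
  obtain ⟨p, ⟨⟨hpN, hpV⟩, hpt⟩, hpK⟩ :=
    h _ (inter_mem h1 (φ.open_target.mem_nhds (φ.map_source hq)))
  exact ⟨φ.symm p, hpN, hpV, by rwa [mem_preimage, φ.right_inv hpt]⟩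

theorem mem_closure_univ_prod_Ioi {p : ℝ × ℝ} :
    p ∈ closure ((univ : Set ℝ) ×ˢ Ioi (0 : ℝ)) ↔ 0 ≤ p.2 := by
  simp [closure_prod_eq, closure_Ioi, mem_prod]

theorem mem_closure_univ_prod_Iio {p : ℝ × ℝ} :
    p ∈ closure ((univ : Set ℝ) ×ˢ Iio (0 : ℝ)) ↔ p.2 ≤ 0 := by
  simp [closure_prod_eq, closure_Iio, mem_prod]

/-- In the chart `ψ` around `y`, the set `Γ` is the first coordinate axis. The point `y` is not
required to lie on `Γ`. -/
def IsStraightChart (Γ : Set Y) (ψ : OpenPartialHomeomorph Y (ℝ × ℝ)) (y : Y) : Prop :=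
  y ∈ ψ.source ∧ ∀ q ∈ ψ.source, q ∈ Γ ↔ (ψ q).2 = 0

/-- In the chart `φ` centred at `c`, the set `Γ` is the union of the two coordinate axes. -/
def IsCrossChart (Γ : Set Y) (φ : OpenPartialHomeomorph Y (ℝ × ℝ)) (c : Y) : Prop :=
  c ∈ φ.source ∧ φ c = 0 ∧ ∀ q ∈ φ.source, q ∈ Γ ↔ (φ q).1 = 0 ∨ (φ q).2 = 0

/-- The indicator function of the positive half-line, with values in `ZMod 2`. -/
noncomputable def posInd (t : ℝ) : ZMod 2 := if 0 < t then 1 else 0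

theorem posInd_of_pos {t : ℝ} (h : 0 < t) : posInd t = 1 := if_pos h

theorem posInd_of_neg {t : ℝ} (h : t < 0) : posInd t = 0 := if_neg h.le.not_gt

theorem eventually_posInd_eq {f : Y → ℝ} {y : Y} (hf : ContinuousAt f y) (h : f y ≠ 0) :
    ∀ᶠ q in 𝓝 y, posInd (f q) = posInd (f y) := by
  rcases h.lt_or_gt with h | h
  · filter_upwards [hf.eventually_lt continuousAt_const h] with q hq
    rw [posInd_of_neg hq, posInd_of_neg h]
  · filter_upwards [continuousAt_const.eventually_lt hf h] with q hq
    rw [posInd_of_pos hq, posInd_of_pos h]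

theorem continuousAt_chart_fst (φ : OpenPartialHomeomorph Y (ℝ × ℝ)) {y : Y}
    (hy : y ∈ φ.source) : ContinuousAt (fun q => (φ q).1) y :=
  continuous_fst.continuousAt.comp (φ.continuousAt hy)

theorem continuousAt_chart_snd (φ : OpenPartialHomeomorph Y (ℝ × ℝ)) {y : Y}
    (hy : y ∈ φ.source) : ContinuousAt (fun q => (φ q).2) y :=
  continuous_snd.continuousAt.comp (φ.continuousAt hy)

/-- Two straight charts at a point of `Γ` see the same two sides of `Γ`, possibly in opposite
order. -/
theorem IsStraightChart.exists_posInd_eq_add {ψ ψ' : OpenPartialHomeomorph Y (ℝ × ℝ)} {y : Y}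
    (hψ : IsStraightChart Γ ψ y) (hψ' : IsStraightChart Γ ψ' y) (hy : y ∈ Γ) :
    ∃ k, ∀ᶠ q in 𝓝 y, q ∉ Γ → posInd (ψ' q).2 = posInd (ψ q).2 + k := by
  obtain ⟨V, hVo, hyV, hVN, hVs, hVK⟩ := exists_chart_box ψ hψ.1 (ψ'.open_source.mem_nhds hψ'.1)
  have hoff : ∀ q ∈ V, (ψ q).2 ≠ 0 → q ∉ Γ := fun q hq h hΓ => h ((hψ.2 q (hVs hq)).1 hΓ)
  -- the side seen by `ψ'` is constant on each side seen by `ψ`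
  have hconst : ∀ K : Set (ℝ × ℝ), Convex ℝ K → (∀ p ∈ K, p.2 ≠ 0) →
      ∃ α, ∀ q ∈ V ∩ ψ ⁻¹' K, posInd (ψ' q).2 = α := by
    intro K hK hK0
    rcases (V ∩ ψ ⁻¹' K).eq_empty_or_nonempty with h | ⟨q₀, hq₀⟩
    · exact ⟨0, fun q hq => by simp [h] at hq⟩
    · refine ⟨_, fun q hq => (hVK K hK).eq_of_eventually_eq (g := fun q => posInd (ψ' q).2) ?_
        hq hq₀⟩
      rintro x ⟨hxV, hxK⟩
      refine nhdsWithin_le_nhds (eventually_posInd_eq (continuousAt_chart_snd ψ' (hVN hxV)) ?_)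
      exact fun h => hoff x hxV (hK0 _ hxK) ((hψ'.2 x (hVN hxV)).2 h)
  obtain ⟨α, hα⟩ := hconst (univ ×ˢ Ioi 0) (convex_univ.prod (convex_Ioi 0))
    (fun p hp => (mem_Ioi.1 hp.2).ne')
  obtain ⟨β, hβ⟩ := hconst (univ ×ˢ Iio 0) (convex_univ.prod (convex_Iio 0))
    (fun p hp => (mem_Iio.1 hp.2).ne)
  have hcases : ∀ q ∈ V, q ∉ Γ →
      (q ∈ V ∩ ψ ⁻¹' (univ ×ˢ Ioi 0)) ∨ (q ∈ V ∩ ψ ⁻¹' (univ ×ˢ Iio 0)) := by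
    intro q hq hΓ
    have h0 : (ψ q).2 ≠ 0 := fun h => hΓ ((hψ.2 q (hVs hq)).2 h)
    rcases h0.lt_or_gt with h | h
    · exact Or.inr ⟨hq, trivial, h⟩
    · exact Or.inl ⟨hq, trivial, h⟩
  -- both values of the side seen by `ψ'` occur near `y`, hence `α ≠ β`
  have hαβ : α ≠ β := by
    rintro rfl
    have hall : ∀ q ∈ V, q ∉ Γ → posInd (ψ' q).2 = α := fun q hq hΓ =>
      (hcases q hq hΓ).elim (hα q) (hβ q)
    have hy0 : (ψ' y).2 = 0 := (hψ'.2 y hψ'.1).1 hy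
    obtain ⟨q₁, hq₁⟩ := closure_nonempty_iff.1 ⟨y, mem_closure_inter_chart_preimage ψ' hψ'.1
      (hVo.mem_nhds hyV) (mem_closure_univ_prod_Ioi.2 hy0.ge)⟩
    obtain ⟨q₂, hq₂⟩ := closure_nonempty_iff.1 ⟨y, mem_closure_inter_chart_preimage ψ' hψ'.1
      (hVo.mem_nhds hyV) (mem_closure_univ_prod_Iio.2 hy0.le)⟩
    have p₁ : 0 < (ψ' q₁).2 := hq₁.2.2
    have p₂ : (ψ' q₂).2 < 0 := hq₂.2.2
    have e₁ := hall q₁ hq₁.1 fun h => p₁.ne' ((hψ'.2 _ (hVN hq₁.1)).1 h)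
    have e₂ := hall q₂ hq₂.1 fun h => p₂.ne ((hψ'.2 _ (hVN hq₂.1)).1 h)
    rw [posInd_of_pos p₁] at e₁
    rw [posInd_of_neg p₂] at e₂
    exact zero_ne_one (e₂.trans e₁.symm)
  have hαβ' : α = 1 + β := (by decide : ∀ a b : ZMod 2, a ≠ b → a = 1 + b) α β hαβ
  refine ⟨β, ?_⟩
  filter_upwards [hVo.mem_nhds hyV] with q hq hΓ
  rcases hcases q hq hΓ with h | h
  · rw [hα q h, posInd_of_pos h.2.2, hαβ']
  · rw [hβ q h, posInd_of_neg h.2.2, zero_add]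

/-- Away from its centre, a cross chart restricts to a straight chart along the first axis. -/
theorem IsCrossChart.exists_straight_of_fst_ne_zero {φ : OpenPartialHomeomorph Y (ℝ × ℝ)} {c y : Y}
    (hφ : IsCrossChart Γ φ c) (hy : y ∈ φ.source) (h : (φ y).1 ≠ 0) :
    ∃ ψ : OpenPartialHomeomorph Y (ℝ × ℝ), IsStraightChart Γ ψ y ∧ ∀ q, (ψ q).2 = (φ q).2 := by
  have ho : IsOpen (φ.source ∩ φ ⁻¹' {p | p.1 ≠ 0}) :=
    φ.isOpen_inter_preimage (isOpen_ne_fun continuous_fst continuous_const)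
  refine ⟨φ.restrOpen _ ho, ⟨⟨hy, hy, h⟩, ?_⟩, fun q => rfl⟩
  rintro q ⟨-, hq, hq'⟩
  exact (hφ.2.2 q hq).trans (or_iff_right hq')

/-- Away from its centre, a cross chart restricts to a straight chart along the second axis. -/
theorem IsCrossChart.exists_straight_of_snd_ne_zero {φ : OpenPartialHomeomorph Y (ℝ × ℝ)} {c y : Y}
    (hφ : IsCrossChart Γ φ c) (hy : y ∈ φ.source) (h : (φ y).2 ≠ 0) :
    ∃ ψ : OpenPartialHomeomorph Y (ℝ × ℝ), IsStraightChart Γ ψ y ∧ ∀ q, (ψ q).2 = (φ q).1 := by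
  have ho : IsOpen (φ.source ∩ φ ⁻¹' {p | p.2 ≠ 0}) :=
    φ.isOpen_inter_preimage (isOpen_ne_fun continuous_snd continuous_const)
  refine ⟨(φ.transHomeomorph (Homeomorph.prodComm ℝ ℝ)).restrOpen _ ho, ⟨⟨hy, hy, h⟩, ?_⟩,
    fun q => rfl⟩
  rintro q ⟨-, hq, hq'⟩
  exact (hφ.2.2 q hq).trans (or_iff_left hq')

/-- The function of two signs `X` and `Y` (with values in `{0, 1}`) that jumps by `aP` and `aM`
across the two halves of the first axis and by `bM` across the negative half of the second one. -/
def cornerModel (aP aM bM X Y : ZMod 2) : ZMod 2 := X * bM + Y * aM + X * Y * (aP + aM)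

end Charts

/-- Jumps prescribed along a curve on the sphere, locally constant away from the crossings and of
sum zero around every crossing, are the jumps of a locally constant function on the complement. -/
theorem exists_locally_constant_with_jumps {Γ C : Set TwoSphere} (hΓ : IsClosed Γ) (hCΓ : C ⊆ Γ)
    (z : TwoSphere → ZMod 2)
    (hflat : ∀ y ∈ Γ, y ∉ C → ∃ ψ, IsStraightChart Γ ψ y)
    (hz : ∀ y ∈ Γ, y ∉ C → ∀ᶠ q in 𝓝 y, q ∈ Γ → q ∉ C ∧ z q = z y)
    (φ : TwoSphere → OpenPartialHomeomorph TwoSphere (ℝ × ℝ))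
    (hφ : ∀ c ∈ C, IsCrossChart Γ (φ c) c) (aP aM bP bM : TwoSphere → ZMod 2)
    (hsum : ∀ c ∈ C, aP c + aM c + bP c + bM c = 0)
    (hzC : ∀ c ∈ C, ∀ᶠ q in 𝓝 c, q ∈ Γ → q ≠ c → q ∉ C ∧
      (0 < (φ c q).1 → z q = aP c) ∧ ((φ c q).1 < 0 → z q = aM c) ∧
      (0 < (φ c q).2 → z q = bP c) ∧ ((φ c q).2 < 0 → z q = bM c)) :
    ∃ g : TwoSphere → ZMod 2, (∀ x ∉ Γ, ∀ᶠ q in 𝓝 x, g q = g x) ∧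
      ∀ c ∈ C, AgreesNear Γ g
        (fun q => cornerModel (aP c) (aM c) (bM c) (posInd (φ c q).1) (posInd (φ c q).2)) c := by
  classical
  have hdense : Dense Γᶜ := by
    intro y
    by_cases hy : y ∈ Γ
    swap
    · exact subset_closure hy
    by_cases hyC : y ∈ C
    · have h := hφ y hyC
      refine closure_mono ?_ (mem_closure_inter_chart_preimage (φ y) h.1
        ((φ y).open_source.mem_nhds h.1) (K := Ioi 0 ×ˢ Ioi 0) ?_)
      · rintro q ⟨hq, hq'⟩ hqΓ
        rcases (h.2.2 q hq).1 hqΓ with h0 | h0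
        · exact (mem_Ioi.1 hq'.1).ne' h0
        · exact (mem_Ioi.1 hq'.2).ne' h0
      · rw [h.2.1, closure_prod_eq, closure_Ioi]
        exact ⟨self_mem_Ici, self_mem_Ici⟩
    · obtain ⟨ψ, h⟩ := hflat y hy hyC
      refine closure_mono ?_ (mem_closure_inter_chart_preimage ψ h.1
        (ψ.open_source.mem_nhds h.1) (mem_closure_univ_prod_Ioi.2 ((h.2 y h.1).1 hy).ge))
      rintro q ⟨hq, hq'⟩ hqΓ
      exact (mem_Ioi.1 hq'.2).ne' ((h.2 q hq).1 hqΓ)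
  have hψ : ∀ y, ∃ ψ, y ∈ Γ → y ∉ C → IsStraightChart Γ ψ y := by
    intro y
    by_cases h : y ∈ Γ ∧ y ∉ C
    · obtain ⟨ψ, hψ⟩ := hflat y h.1 h.2
      exact ⟨ψ, fun _ _ => hψ⟩
    · exact ⟨φ y, fun h1 h2 => absurd ⟨h1, h2⟩ h⟩
  choose ψ hψ using hψ
  let m : TwoSphere → TwoSphere → ZMod 2 := fun y q =>
    if y ∈ Γ then
      if y ∈ C then cornerModel (aP y) (aM y) (bM y) (posInd (φ y q).1) (posInd (φ y q).2)
      else z y * posInd (ψ y q).2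
    else 0
  have m0 : ∀ y ∉ Γ, ∀ q, m y q = 0 := fun y hy q => if_neg hy
  have mC : ∀ y ∈ C, ∀ q, m y q =
      cornerModel (aP y) (aM y) (bM y) (posInd (φ y q).1) (posInd (φ y q).2) := fun y hy q => by
    simp only [m, if_pos (hCΓ hy), if_pos hy]
  have mF : ∀ y ∈ Γ, y ∉ C → ∀ q, m y q = z y * posInd (ψ y q).2 := fun y hy hy' q => by
    simp only [m, if_pos hy, if_neg hy']
  -- off `Γ`, compatibility says that the model at `x` is locally constant
  have hoff : ∀ x, ∀ y ∉ Γ, (∀ᶠ q in 𝓝 y, m x q = m x y) → AgreesNear Γ (m x) (m y) y := by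
    intro x y hy h
    refine ⟨m x y, h.mono fun q hq _ => ?_⟩
    rw [m0 y hy, zero_add, hq]
  -- on `Γ`, it suffices that the model at `x` jumps by `z y` in one straight chart at `y`
  have hon : ∀ x, ∀ y ∈ Γ, y ∉ C → ∀ ψ', IsStraightChart Γ ψ' y →
      (∃ l, ∀ᶠ q in 𝓝 y, m x q = z y * posInd (ψ' q).2 + l) → AgreesNear Γ (m x) (m y) y := by
    rintro x y hy hyC ψ' hψ' ⟨l, hl⟩
    obtain ⟨k, hk⟩ := (hψ y hy hyC).exists_posInd_eq_add hψ' hy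
    refine ⟨z y * k + l, ?_⟩
    filter_upwards [hl, hk] with q h1 h2 hq
    rw [h1, h2 hq, mF y hy hyC]; ring
  have hm : ∀ x, ∀ᶠ y in 𝓝 x, AgreesNear Γ (m x) (m y) y := by
    intro x
    by_cases hx : x ∈ Γ
    swap
    · filter_upwards [hΓ.isOpen_compl.mem_nhds hx] with y hy
      exact hoff x y hy (Eventually.of_forall fun q => by rw [m0 x hx, m0 x hx])
    by_cases hxC : x ∈ C
    · have hc := hφ x hxC
      filter_upwards [(φ x).open_source.mem_nhds hc.1, hzC x hxC] with y hys hyz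
      by_cases hyx : y = x
      · subst hyx
        exact ⟨0, Eventually.of_forall fun q _ => (add_zero _).symm⟩
      have hfst := fun h : (φ x y).1 ≠ 0 => eventually_posInd_eq (continuousAt_chart_fst _ hys) h
      have hsnd := fun h : (φ x y).2 ≠ 0 => eventually_posInd_eq (continuousAt_chart_snd _ hys) h
      by_cases hy : y ∈ Γ
      swap
      · have h0 := not_or.1 fun h => hy ((hc.2.2 y hys).2 h)
        refine hoff x y hy ?_
        filter_upwards [hfst h0.1, hsnd h0.2] with q h1 h2
        rw [mC x hxC, mC x hxC, h1, h2]
      · obtain ⟨hyC, z1, z2, z3, z4⟩ := hyz hy hyx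
        have hs := hsum x hxC
        by_cases h1 : (φ x y).1 = 0
        · have h2 : (φ x y).2 ≠ 0 := fun h2 => hyx ((φ x).injOn hys hc.1
            (by rw [hc.2.1]; exact Prod.ext h1 h2))
          obtain ⟨ψ', hψ', he⟩ := hc.exists_straight_of_snd_ne_zero hys h2
          refine hon x y hy hyC ψ' hψ' ?_
          rcases h2.lt_or_gt with h2' | h2'
          · refine ⟨0, (hsnd h2).mono fun q hq => ?_⟩
            rw [mC x hxC, hq, posInd_of_neg h2', he, z4 h2', cornerModel]
            ring
          · refine ⟨aM x, (hsnd h2).mono fun q hq => ?_⟩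
            have e : bP x = aP x + aM x + bM x := by
              revert hs
              generalize aP x = a, aM x = b, bP x = c, bM x = d
              revert a b c d
              decide
            rw [mC x hxC, hq, posInd_of_pos h2', he, z3 h2', cornerModel, e]
            ring
        · obtain ⟨ψ', hψ', he⟩ := hc.exists_straight_of_fst_ne_zero hys h1
          refine hon x y hy hyC ψ' hψ' ?_
          rcases Ne.lt_or_gt h1 with h1' | h1'
          · refine ⟨0, (hfst h1).mono fun q hq => ?_⟩
            rw [mC x hxC, hq, posInd_of_neg h1', he, z2 h1', cornerModel]
            ring
          · refine ⟨bM x, (hfst h1).mono fun q hq => ?_⟩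
            have e : ∀ a b c y : ZMod 2, cornerModel a b c 1 y = a * y + c := by decide
            rw [mC x hxC, hq, posInd_of_pos h1', he, z1 h1', e]
    · have hs := hψ x hx hxC
      filter_upwards [(ψ x).open_source.mem_nhds hs.1, hz x hx hxC] with y hys hyz
      by_cases hy : y ∈ Γ
      · refine hon x y hy (hyz hy).1 (ψ x) ⟨hys, hs.2⟩ ⟨0, Eventually.of_forall fun q => ?_⟩
        rw [mF x hx hxC, (hyz hy).2, add_zero]
      · refine hoff x y hy ?_
        have h0 : (ψ x y).2 ≠ 0 := fun h => hy ((hs.2 y hys).2 h)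
        filter_upwards [eventually_posInd_eq (continuousAt_chart_snd _ hys) h0] with q h1
        rw [mF x hx hxC, mF x hx hxC, h1]
  obtain ⟨g, hg⟩ := glued_univ_twoSphere hdense hm
  refine ⟨g, fun x hx => ?_, fun c hc => ?_⟩
  · obtain ⟨k, hk⟩ := hg x (mem_univ x)
    filter_upwards [hk, hΓ.isOpen_compl.mem_nhds hx] with q h1 h2
    rw [h1 h2, hk.self_of_nhds hx, m0 x hx, m0 x hx]
  · obtain ⟨k, hk⟩ := hg c (mem_univ c)
    refine ⟨k, hk.mono fun q h hq => ?_⟩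
    rw [h hq, mC c hc]

/-! ### Regions near the curve -/

/-- The positive or the negative open half-line. -/
def openHalfLine : Bool → Set ℝ
  | true => Ioi 0
  | false => Iio 0

/-- The four open quadrants of the plane. -/
def quadrant (a b : Bool) : Set (ℝ × ℝ) := openHalfLine a ×ˢ openHalfLine b

theorem convex_openHalfLine (a : Bool) : Convex ℝ (openHalfLine a) := by
  cases a
  · exact convex_Iio 0
  · exact convex_Ioi 0

theorem isOpen_openHalfLine (a : Bool) : IsOpen (openHalfLine a) := by
  cases a
  · exact isOpen_Iio
  · exact isOpen_Ioi

theorem zero_mem_closure_openHalfLine (a : Bool) : (0 : ℝ) ∈ closure (openHalfLine a) := by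
  cases a
  · exact (closure_Iio (0 : ℝ)).ge self_mem_Iic
  · exact (closure_Ioi (0 : ℝ)).ge self_mem_Ici

theorem ne_zero_of_mem_openHalfLine {a : Bool} {t : ℝ} (h : t ∈ openHalfLine a) : t ≠ 0 := by
  cases a
  · exact (mem_Iio.1 h).ne
  · exact (mem_Ioi.1 h).ne'

theorem exists_mem_openHalfLine {t : ℝ} (h : t ≠ 0) : ∃ a, t ∈ openHalfLine a := by
  rcases h.lt_or_gt with h | h
  · exact ⟨false, h⟩
  · exact ⟨true, h⟩

/-- The two-valued indicator of a sign. -/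
def signInd (a : Bool) : ZMod 2 := if a then 1 else 0

theorem posInd_of_mem_openHalfLine {a : Bool} {t : ℝ} (h : t ∈ openHalfLine a) :
    posInd t = signInd a := by
  cases a
  · exact posInd_of_neg h
  · exact posInd_of_pos h

namespace LinkProjection

variable {L : LinkProjection} {R S : Set TwoSphere}

theorem isClosed_range_curve (L : LinkProjection) : IsClosed (range L.curve) :=
  (isCompact_range L.curve.continuous).isClosed

theorem isPreconnected_of_mem_regions (hR : R ∈ L.regions) : IsPreconnected R := by
  obtain ⟨q, -, rfl⟩ := hR
  exact isPreconnected_connectedComponentIn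

theorem notMem_range_of_mem_region (hR : R ∈ L.regions) {q : TwoSphere} (hq : q ∈ R) :
    q ∉ range L.curve := by
  obtain ⟨p, -, rfl⟩ := hR
  exact connectedComponentIn_subset _ _ hq

theorem region_eq_of_mem (hR : R ∈ L.regions) (hS : S ∈ L.regions) {q : TwoSphere}
    (hqR : q ∈ R) (hqS : q ∈ S) : R = S := by
  obtain ⟨p, -, rfl⟩ := hR
  obtain ⟨p', -, rfl⟩ := hS
  rw [connectedComponentIn_eq hqR, connectedComponentIn_eq hqS]

theorem exists_region_superset {T : Set TwoSphere} (hT : IsPreconnected T) (hne : T.Nonempty)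
    (hΓ : ∀ q ∈ T, q ∉ range L.curve) : ∃ R ∈ L.regions, T ⊆ R := by
  obtain ⟨q, hq⟩ := hne
  exact ⟨_, ⟨q, hΓ q hq, rfl⟩, hT.subset_connectedComponentIn hq hΓ⟩

/-- The regions whose closure contains `q`. For a point of the curve that is not a crossing these
are the regions on the two sides of the curve. -/
def regionsAt (L : LinkProjection) (q : TwoSphere) : Set (Set TwoSphere) :=
  {R | R ∈ L.regions ∧ q ∈ closure R}

theorem regionsAt_eq_pair (φ : OpenPartialHomeomorph TwoSphere (ℝ × ℝ)) {q : TwoSphere}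
    (hq : q ∈ φ.source) (hR : R ∈ L.regions) (hS : S ∈ L.regions) {V : Set TwoSphere}
    (hV : V ∈ 𝓝 q) {K₁ K₂ : Set (ℝ × ℝ)}
    (hK : ∀ᶠ q' in 𝓝 q, q' ∉ range L.curve → φ q' ∈ K₁ ∨ φ q' ∈ K₂)
    (hVR : V ∩ φ ⁻¹' K₁ ⊆ R) (hVS : V ∩ φ ⁻¹' K₂ ⊆ S) (h₁ : φ q ∈ closure K₁)
    (h₂ : φ q ∈ closure K₂) : L.regionsAt q = {R, S} := by
  ext T
  constructor
  · rintro ⟨hT, hqT⟩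
    obtain ⟨q', ⟨hq'V, hq'K⟩, hq'T⟩ := mem_closure_iff_nhds.1 hqT _ (inter_mem hV hK)
    rcases hq'K (notMem_range_of_mem_region hT hq'T) with h | h
    · exact Or.inl (region_eq_of_mem hT hR hq'T (hVR ⟨hq'V, h⟩))
    · exact Or.inr (region_eq_of_mem hT hS hq'T (hVS ⟨hq'V, h⟩))
  · rintro (rfl | rfl)
    · exact ⟨hR, closure_mono hVR (mem_closure_inter_chart_preimage φ hq hV h₁)⟩
    · exact ⟨hS, closure_mono hVS (mem_closure_inter_chart_preimage φ hq hV h₂)⟩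

/-- The regions on the two sides of the curve do not change along the curve. -/
theorem eventually_regionsAt_eq {ψ : OpenPartialHomeomorph TwoSphere (ℝ × ℝ)} {p : TwoSphere}
    (hψ : IsStraightChart (range L.curve) ψ p) (hp : p ∈ range L.curve) :
    ∀ᶠ q in 𝓝 p, q ∈ range L.curve → L.regionsAt q = L.regionsAt p := by
  obtain ⟨V, hVo, hpV, -, hVs, hVK⟩ := exists_chart_box ψ hψ.1 univ_mem
  have h0 : ∀ q ∈ V, q ∈ range L.curve → (ψ q).2 = 0 := fun q hq => (hψ.2 q (hVs hq)).1
  have hreg : ∀ a, ∃ R ∈ L.regions, V ∩ ψ ⁻¹' (univ ×ˢ openHalfLine a) ⊆ R := by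
    intro a
    refine exists_region_superset (hVK _ (convex_univ.prod (convex_openHalfLine a))) ?_ ?_
    · refine closure_nonempty_iff.1 ⟨p, mem_closure_inter_chart_preimage ψ hψ.1
        (hVo.mem_nhds hpV) ?_⟩
      rw [closure_prod_eq, closure_univ]
      exact ⟨trivial, by rw [h0 p hpV hp]; exact zero_mem_closure_openHalfLine a⟩
    · exact fun q hq hqΓ => ne_zero_of_mem_openHalfLine hq.2.2 (h0 q hq.1 hqΓ)
  choose R hR hVR using hreg
  have key : ∀ q ∈ V, q ∈ range L.curve → L.regionsAt q = {R true, R false} := by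
    intro q hq hqΓ
    have hcl : ∀ a, ψ q ∈ closure (univ ×ˢ openHalfLine a) := fun a => by
      rw [closure_prod_eq, closure_univ]
      exact ⟨trivial, by rw [h0 q hq hqΓ]; exact zero_mem_closure_openHalfLine a⟩
    refine regionsAt_eq_pair ψ (hVs hq) (hR _) (hR _) (hVo.mem_nhds hq) ?_ (hVR _) (hVR _)
      (hcl _) (hcl _)
    filter_upwards [hVo.mem_nhds hq] with q' hq' hq'Γ
    obtain ⟨a, ha⟩ := exists_mem_openHalfLine fun h => hq'Γ ((hψ.2 q' (hVs hq')).2 h)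
    cases a
    · exact Or.inr ⟨trivial, ha⟩
    · exact Or.inl ⟨trivial, ha⟩
  filter_upwards [hVo.mem_nhds hpV] with q hq hqΓ
  rw [key q hq hqΓ, key p hpV hp]

/-- The family `r` consists of the regions in the four quadrants of the chart `φ` at `c`. -/
def IsCornerFamily (L : LinkProjection) (φ : OpenPartialHomeomorph TwoSphere (ℝ × ℝ))
    (c : TwoSphere) (r : Bool → Bool → Set TwoSphere) : Prop :=
  (∀ a b, r a b ∈ L.regions) ∧ ∀ᶠ q in 𝓝 c, ∀ a b, φ q ∈ quadrant a b → q ∈ r a b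

section Corners

variable {φ : OpenPartialHomeomorph TwoSphere (ℝ × ℝ)} {c : TwoSphere}

theorem zero_mem_closure_quadrant (a b : Bool) : (0 : ℝ × ℝ) ∈ closure (quadrant a b) := by
  rw [quadrant, closure_prod_eq]
  exact ⟨zero_mem_closure_openHalfLine a, zero_mem_closure_openHalfLine b⟩

theorem exists_mem_quadrant (hφ : IsCrossChart (range L.curve) φ c) {q : TwoSphere}
    (hq : q ∈ φ.source) (hqΓ : q ∉ range L.curve) : ∃ a b, φ q ∈ quadrant a b := by
  have h0 := not_or.1 fun h => hqΓ ((hφ.2.2 q hq).2 h)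
  obtain ⟨a, ha⟩ := exists_mem_openHalfLine h0.1
  obtain ⟨b, hb⟩ := exists_mem_openHalfLine h0.2
  exact ⟨a, b, ha, hb⟩

theorem exists_isCornerFamily (hφ : IsCrossChart (range L.curve) φ c) :
    ∃ r, L.IsCornerFamily φ c r := by
  obtain ⟨V, hVo, hcV, -, hVs, hVK⟩ := exists_chart_box φ hφ.1 univ_mem
  have hreg : ∀ a b, ∃ R ∈ L.regions, V ∩ φ ⁻¹' quadrant a b ⊆ R := by
    intro a b
    refine exists_region_superset
      (hVK _ ((convex_openHalfLine a).prod (convex_openHalfLine b))) ?_ ?_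
    · refine closure_nonempty_iff.1 ⟨c, mem_closure_inter_chart_preimage φ hφ.1
        (hVo.mem_nhds hcV) ?_⟩
      rw [hφ.2.1]
      exact zero_mem_closure_quadrant a b
    · intro q hq hqΓ
      rcases (hφ.2.2 q (hVs hq.1)).1 hqΓ with h | h
      · exact ne_zero_of_mem_openHalfLine hq.2.1 h
      · exact ne_zero_of_mem_openHalfLine hq.2.2 h
  choose r hr hVr using hreg
  refine ⟨r, hr, ?_⟩
  filter_upwards [hVo.mem_nhds hcV] with q hq a b h
  exact hVr a b ⟨hq, h⟩

variable {r : Bool → Bool → Set TwoSphere}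

/-- The only regions that reach a crossing are those in its four corners. -/
theorem IsCornerFamily.eq_of_mem_closure (hr : L.IsCornerFamily φ c r)
    (hφ : IsCrossChart (range L.curve) φ c) (hR : R ∈ L.regions) (hc : c ∈ closure R) :
    ∃ a b, R = r a b := by
  obtain ⟨q, ⟨hq, hqs⟩, hqR⟩ :=
    mem_closure_iff_nhds.1 hc _ (inter_mem hr.2 (φ.open_source.mem_nhds hφ.1))
  obtain ⟨a, b, hab⟩ := exists_mem_quadrant hφ hqs (notMem_range_of_mem_region hR hqR)
  exact ⟨a, b, region_eq_of_mem hR (hr.1 a b) hqR (hq a b hab)⟩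

/-- Near a crossing, the regions along a half-axis are those in the two adjacent corners. -/
theorem IsCornerFamily.eventually_regionsAt_eq (hr : L.IsCornerFamily φ c r)
    (hφ : IsCrossChart (range L.curve) φ c) : ∀ᶠ q in 𝓝 c,
      (∀ a, (φ q).1 ∈ openHalfLine a → (φ q).2 = 0 → L.regionsAt q = {r a true, r a false}) ∧
      (∀ b, (φ q).2 ∈ openHalfLine b → (φ q).1 = 0 → L.regionsAt q = {r true b, r false b}) := by
  obtain ⟨V, hV, hVo, hcV⟩ :=
    eventually_nhds_iff.1 (hr.2.and (φ.open_source.mem_nhds hφ.1))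
  have hVr : ∀ a b, V ∩ φ ⁻¹' quadrant a b ⊆ r a b := fun a b q hq => (hV q hq.1).1 a b hq.2
  filter_upwards [hVo.mem_nhds hcV] with q hqV
  have hqs := (hV q hqV).2
  have hsV : ∀ᶠ q' in 𝓝 q, q' ∈ V := hVo.mem_nhds hqV
  constructor
  · intro a ha h0
    have hcl : ∀ b, φ q ∈ closure (quadrant a b) := fun b => by
      rw [quadrant, closure_prod_eq]
      exact ⟨subset_closure ha, by rw [h0]; exact zero_mem_closure_openHalfLine b⟩
    refine regionsAt_eq_pair φ hqs (hr.1 _ _) (hr.1 _ _) (hVo.mem_nhds hqV) ?_ (hVr _ _) (hVr _ _)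
      (hcl _) (hcl _)
    filter_upwards [hsV, (continuousAt_chart_fst φ hqs).preimage_mem_nhds
      ((isOpen_openHalfLine a).mem_nhds ha)] with q' hq' ha' hq'Γ
    have h2 := (not_or.1 fun h => hq'Γ ((hφ.2.2 q' (hV q' hq').2).2 h)).2
    obtain ⟨b, hb⟩ := exists_mem_openHalfLine h2
    cases b
    · exact Or.inr ⟨ha', hb⟩
    · exact Or.inl ⟨ha', hb⟩
  · intro b hb h0
    have hcl : ∀ a, φ q ∈ closure (quadrant a b) := fun a => by
      rw [quadrant, closure_prod_eq]
      exact ⟨by rw [h0]; exact zero_mem_closure_openHalfLine a, subset_closure hb⟩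
    refine regionsAt_eq_pair φ hqs (hr.1 _ _) (hr.1 _ _) (hVo.mem_nhds hqV) ?_ (hVr _ _) (hVr _ _)
      (hcl _) (hcl _)
    filter_upwards [hsV, (continuousAt_chart_snd φ hqs).preimage_mem_nhds
      ((isOpen_openHalfLine b).mem_nhds hb)] with q' hq' hb' hq'Γ
    have h1 := (not_or.1 fun h => hq'Γ ((hφ.2.2 q' (hV q' hq').2).2 h)).1
    obtain ⟨a, ha⟩ := exists_mem_openHalfLine h1
    cases a
    · exact Or.inr ⟨ha, hb'⟩
    · exact Or.inl ⟨ha, hb'⟩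

/-- A locally constant function on the complement of the curve is a function of the regions. -/
theorem exists_region_coloring {g : TwoSphere → ZMod 2}
    (hg : ∀ x ∉ range L.curve, ∀ᶠ q in 𝓝 x, g q = g x) :
    ∃ w : Set TwoSphere → ZMod 2, ∀ R ∈ L.regions, ∀ q ∈ R, g q = w R := by
  have : ∀ R, ∃ k, R ∈ L.regions → ∀ q ∈ R, g q = k := by
    intro R
    rcases R.eq_empty_or_nonempty with rfl | ⟨p, hp⟩
    · exact ⟨0, fun _ q hq => absurd hq (notMem_empty q)⟩
    · refine ⟨g p, fun hR q hq => (isPreconnected_of_mem_regions hR).eq_of_eventually_eq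
        (fun x hx => nhdsWithin_le_nhds (hg x (notMem_range_of_mem_region hR hx))) hq hp⟩
  choose w hw using this
  exact ⟨w, hw⟩

theorem IsCornerFamily.coloring_eq (hr : L.IsCornerFamily φ c r)
    (hφ : IsCrossChart (range L.curve) φ c) {g : TwoSphere → ZMod 2} {w : Set TwoSphere → ZMod 2}
    (hw : ∀ R ∈ L.regions, ∀ q ∈ R, g q = w R) {aP aM bM : ZMod 2}
    (hg : AgreesNear (range L.curve) g
      (fun q => cornerModel aP aM bM (posInd (φ q).1) (posInd (φ q).2)) c) :
    ∃ k, ∀ a b, w (r a b) = cornerModel aP aM bM (signInd a) (signInd b) + k := by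
  obtain ⟨k, hk⟩ := hg
  refine ⟨k, fun a b => ?_⟩
  obtain ⟨q, ⟨hq1, hq2⟩, hq3⟩ := closure_nonempty_iff.1 ⟨c, mem_closure_inter_chart_preimage φ hφ.1
    (inter_mem hk hr.2) (K := quadrant a b) (by rw [hφ.2.1]; exact zero_mem_closure_quadrant a b)⟩
  have hqr : q ∈ r a b := hq2 a b hq3
  rw [← hw _ (hr.1 a b) q hqr, hq1 (notMem_range_of_mem_region (hr.1 a b) hqr)]
  dsimp only
  rw [posInd_of_mem_openHalfLine hq3.1, posInd_of_mem_openHalfLine hq3.2]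

end Corners

end LinkProjection

/-! ### Arcs between marked points of circles -/

/-- Rotation by the angle `u` on a disjoint union of circles. -/
noncomputable def circleFlow {ι : Type*} (x : ι × Circle) (u : ℝ) : ι × Circle :=
  (x.1, x.2 * Circle.exp u)

section Algebra

variable {ι : Type*} {D : Set (ι × Circle)} {x y : ι × Circle}

theorem circleFlow_add (x : ι × Circle) (u v : ℝ) :
    circleFlow (circleFlow x u) v = circleFlow x (u + v) := by
  simp [circleFlow, Circle.exp_add, mul_assoc]

@[simp]
theorem circleFlow_zero (x : ι × Circle) : circleFlow x 0 = x := by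
  simp [circleFlow]

theorem circleFlow_ne_self {u : ℝ} (h₀ : 0 < u) (h₁ : u < 2 * Real.pi) : circleFlow x u ≠ x := by
  intro h
  have h2 : Circle.exp u = 1 := mul_eq_left.1 (congrArg Prod.snd h)
  obtain ⟨n, hn⟩ := Circle.exp_eq_one.1 h2
  have hpi := Real.two_pi_pos
  rw [hn] at h₀ h₁
  have : (0 : ℝ) < n := pos_of_mul_pos_left h₀ hpi.le
  have h3 : (n : ℝ) < 1 := by
    by_contra h
    nlinarith
  have h4 : 0 < n := by exact_mod_cast this
  have h5 : n < 1 := by exact_mod_cast h3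
  omega

theorem exists_pos_circleFlow_neg_eq (h : x.1 = y.1) : ∃ u > 0, circleFlow x (-u) = y := by
  obtain ⟨t, ht⟩ := Circle.exp_surjective (x.2 * y.2⁻¹)
  obtain ⟨n, hn⟩ := exists_nat_gt (-t / (2 * Real.pi))
  refine ⟨t + n * (2 * Real.pi), ?_, ?_⟩
  · rw [div_lt_iff₀ Real.two_pi_pos] at hn
    linarith
  · have : Circle.exp (t + n * (2 * Real.pi)) = x.2 * y.2⁻¹ := by
      rw [← ht]
      exact Circle.exp_eq_exp.2 ⟨n, by push_cast; ring⟩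
    refine Prod.ext h ?_
    rw [circleFlow, Circle.exp_neg, this]
    simp

/-- Going backwards from `x`, the first marked point is met after rotating by `τ`. -/
def IsBackTime (D : Set (ι × Circle)) (x : ι × Circle) (τ : ℝ) : Prop :=
  0 < τ ∧ circleFlow x (-τ) ∈ D ∧ ∀ v, 0 < v → v < τ → circleFlow x (-v) ∉ D

theorem IsBackTime.unique {τ τ' : ℝ} (h : IsBackTime D x τ) (h' : IsBackTime D x τ') : τ = τ' := by
  rcases lt_trichotomy τ τ' with hlt | rfl | hlt
  · exact absurd h.2.1 (h'.2.2 τ h.1 hlt)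
  · rfl
  · exact absurd h'.2.1 (h.2.2 τ' h'.1 hlt)

open Classical in
/-- The last marked point strictly before `x` on the circle of `x`. If that circle has no marked
points, the value is `x` itself. -/
noncomputable def prevMarked (D : Set (ι × Circle)) (x : ι × Circle) : ι × Circle :=
  if h : ∃ τ, IsBackTime D x τ then circleFlow x (-h.choose) else x

theorem IsBackTime.prevMarked_eq {τ : ℝ} (h : IsBackTime D x τ) :
    prevMarked D x = circleFlow x (-τ) := by
  have h' : ∃ τ, IsBackTime D x τ := ⟨τ, h⟩
  rw [prevMarked, dif_pos h', h'.choose_spec.unique h]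

/-- Different marked points have different predecessors. -/
theorem IsBackTime.eq_of_prevMarked_eq {τ τ' : ℝ} (hx : x ∈ D) (hy : y ∈ D)
    (h : IsBackTime D x τ) (h' : IsBackTime D y τ') (he : prevMarked D x = prevMarked D y) :
    x = y := by
  rw [h.prevMarked_eq, h'.prevMarked_eq] at he
  have e1 : x = circleFlow y (-(τ' - τ)) := by
    have := congrArg (circleFlow · τ) he
    simp only [circleFlow_add] at this
    simpa [add_comm, sub_eq_add_neg] using this
  have e2 : y = circleFlow x (-(τ - τ')) := by
    rw [e1, circleFlow_add]; simp
  rcases lt_trichotomy τ τ' with hlt | rfl | hlt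
  · exact absurd (e1 ▸ hx) (h'.2.2 _ (sub_pos.2 hlt) (by linarith [h.1]))
  · simpa using e1
  · exact absurd (e2 ▸ hy) (h.2.2 _ (sub_pos.2 hlt) (by linarith [h'.1]))

/-- Just before a point with a predecessor, the predecessor is the same. -/
theorem IsBackTime.eventually_prevMarked_eq_left {τ : ℝ} (h : IsBackTime D x τ) :
    ∀ᶠ u in 𝓝[<] 0, prevMarked D (circleFlow x u) = prevMarked D x := by
  filter_upwards [Ioo_mem_nhdsLT (neg_lt_zero.2 h.1)] with u hu
  have h' : IsBackTime D (circleFlow x u) (τ + u) := by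
    refine ⟨by linarith [hu.1], ?_, fun v hv hvu => ?_⟩
    · rw [circleFlow_add]
      convert h.2.1 using 2
      ring
    · rw [circleFlow_add]
      have := h.2.2 (v - u) (by linarith [hu.2]) (by linarith)
      rwa [neg_sub, sub_eq_add_neg] at this
  rw [h'.prevMarked_eq, h.prevMarked_eq, circleFlow_add]
  congr 1
  ring

end Algebra

section Topology

variable {ι : Type*} [TopologicalSpace ι] {D : Set (ι × Circle)} {x : ι × Circle}

theorem continuous_circleFlow (x : ι × Circle) : Continuous (circleFlow x) :=
  continuous_const.prodMk (continuous_const.mul Circle.exp.continuous)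

theorem map_circleFlow_nhds [DiscreteTopology ι] (x : ι × Circle) (u : ℝ) :
    map (circleFlow x) (𝓝 u) = 𝓝 (circleFlow x u) := by
  have h1 : map Circle.exp (𝓝 u) = 𝓝 (Circle.exp u) := isLocalHomeomorph_circleExp.map_nhds_eq u
  have h2 : map (fun z : Circle => x.2 * z) (𝓝 (Circle.exp u)) = 𝓝 (x.2 * Circle.exp u) :=
    (Homeomorph.mulLeft x.2).map_nhds_eq _
  have h3 : map (fun z : Circle => (x.1, z)) (𝓝 (x.2 * Circle.exp u)) =
      𝓝 (x.1, x.2 * Circle.exp u) := by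
    rw [nhds_prod_eq, nhds_discrete ι, pure_prod]
  rw [circleFlow, ← h3, ← h2, ← h1, map_map, map_map]
  rfl

theorem nhds_eq_map_circleFlow [DiscreteTopology ι] (x : ι × Circle) :
    𝓝 x = map (circleFlow x) (𝓝 0) := by
  rw [map_circleFlow_nhds, circleFlow_zero]

/-- A function that is locally constant away from the marked points has the same value at the two
ends of an arc. -/
theorem IsBackTime.eq_along_arc [DiscreteTopology ι] {α : Type*} {F : ι × Circle → α}
    (hF : ∀ y ∉ D, ∀ᶠ y' in 𝓝 y, F y' = F y) {τ : ℝ} (h : IsBackTime D x τ) {a b : α}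
    (ha : ∀ᶠ u in 𝓝[>] 0, F (circleFlow (prevMarked D x) u) = a)
    (hb : ∀ᶠ u in 𝓝[<] 0, F (circleFlow x u) = b) : a = b := by
  obtain ⟨u, hua, hu⟩ := (ha.and (Ioo_mem_nhdsGT h.1)).exists
  obtain ⟨v, hvb, hv⟩ := (hb.and (Ioo_mem_nhdsLT (neg_lt_zero.2 h.1))).exists
  rw [h.prevMarked_eq, circleFlow_add] at hua
  rw [← hua, ← hvb]
  refine (isPreconnected_Ioo (a := -τ) (b := 0)).eq_of_eventually_eq
    (g := fun s => F (circleFlow x s)) ?_ ⟨by linarith [hu.1], by linarith [hu.2]⟩ hv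
  intro s hs
  have hsD : circleFlow x s ∉ D := by
    have := h.2.2 (-s) (by linarith [hs.2]) (by linarith [hs.1])
    rwa [neg_neg] at this
  exact nhdsWithin_le_nhds ((continuous_circleFlow x).continuousAt.eventually (hF _ hsD))

variable [T1Space ι]

/-- Apart from the start, marked points are not met at small angles. -/
theorem eventually_circleFlow_notMem (hD : D.Finite) (x : ι × Circle) :
    ∀ᶠ u in 𝓝 0, u ≠ 0 → circleFlow x u ∉ D := by
  have h1 : (D \ {x})ᶜ ∈ 𝓝 (circleFlow x 0) := by
    rw [circleFlow_zero]
    exact hD.sdiff.isClosed.isOpen_compl.mem_nhds fun h => h.2 rfl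
  have hpi := Real.two_pi_pos
  filter_upwards [(continuous_circleFlow x).continuousAt.preimage_mem_nhds h1,
    Ioo_mem_nhds (neg_lt_zero.2 hpi) hpi] with u hu hu' hu0 hmem
  refine hu ⟨hmem, fun h => ?_⟩
  have h : circleFlow x u = x := h
  rcases hu0.lt_or_gt with hneg | hpos
  · refine circleFlow_ne_self (x := circleFlow x u) (u := -u) (by linarith) (by linarith [hu'.1]) ?_
    rw [circleFlow_add, add_neg_cancel, circleFlow_zero, h]
  · exact circleFlow_ne_self hpos hu'.2 h

theorem exists_circleFlow_notMem (hD : D.Finite) (x : ι × Circle) :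
    ∃ ε > 0, ∀ u, |u| < ε → u ≠ 0 → circleFlow x u ∉ D := by
  obtain ⟨ε, hε, h⟩ := Metric.eventually_nhds_iff.1 (eventually_circleFlow_notMem hD x)
  exact ⟨ε, hε, fun u hu => h (by simpa using hu)⟩

/-- On a circle with marked points, every point has a predecessor. -/
theorem exists_isBackTime (hD : D.Finite) {d : ι × Circle} (hd : d ∈ D) (h : x.1 = d.1) :
    ∃ τ, IsBackTime D x τ := by
  obtain ⟨u, hu, hud⟩ := exists_pos_circleFlow_neg_eq h
  obtain ⟨ε, hε, hεD⟩ := exists_circleFlow_notMem hD x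
  let T : Set ℝ := Ici ε ∩ (fun u => circleFlow x (-u)) ⁻¹' D
  have hT : ∀ v, 0 < v → circleFlow x (-v) ∈ D → v ∈ T := by
    refine fun v hv hvD => ⟨?_, hvD⟩
    by_contra hlt
    exact hεD (-v) (by rw [abs_neg, abs_of_pos hv]; exact not_le.1 hlt) (neg_ne_zero.2 hv.ne') hvD
  have hTc : IsClosed T :=
    isClosed_Ici.inter (hD.isClosed.preimage ((continuous_circleFlow x).comp continuous_neg))
  have hTb : BddBelow T := ⟨ε, fun v hv => hv.1⟩
  have hmem := hTc.csInf_mem ⟨u, hT u hu (hud ▸ hd)⟩ hTb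
  refine ⟨sInf T, hε.trans_le hmem.1, hmem.2, fun v hv hlt hvD => ?_⟩
  exact absurd (csInf_le hTb (hT v hv hvD)) (not_le.2 hlt)

/-- Just after a marked point `x`, the preceding marked point is `x`. -/
theorem eventually_prevMarked_eq_self (hD : D.Finite) (hx : x ∈ D) :
    ∀ᶠ u in 𝓝[>] 0, prevMarked D (circleFlow x u) = x := by
  obtain ⟨ε, hε, hεD⟩ := exists_circleFlow_notMem hD x
  filter_upwards [Ioo_mem_nhdsGT hε] with u hu
  have h : IsBackTime D (circleFlow x u) u := by
    refine ⟨hu.1, by rwa [circleFlow_add, add_neg_cancel, circleFlow_zero], fun v hv hvu => ?_⟩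
    rw [circleFlow_add]
    exact hεD _ (by rw [abs_lt]; constructor <;> linarith [hu.2]) (by linarith)
  rw [h.prevMarked_eq, circleFlow_add, add_neg_cancel, circleFlow_zero]

/-- The predecessor is locally constant away from the marked points. -/
theorem IsBackTime.eventually_prevMarked_eq [DiscreteTopology ι] {τ : ℝ} (h : IsBackTime D x τ)
    (hD : D.Finite) (hx : x ∉ D) : ∀ᶠ y in 𝓝 x, prevMarked D y = prevMarked D x := by
  obtain ⟨ε, hε, hεD⟩ := exists_circleFlow_notMem hD x
  rw [nhds_eq_map_circleFlow, eventually_map]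
  filter_upwards [Ioo_mem_nhds (neg_lt_zero.2 h.1) hε] with u hu
  have h' : IsBackTime D (circleFlow x u) (τ + u) := by
    refine ⟨by linarith [hu.1], ?_, fun v hv hvu => ?_⟩
    · rw [circleFlow_add]
      convert h.2.1 using 2
      ring
    · rw [circleFlow_add]
      rcases lt_trichotomy v u with hlt | rfl | hlt
      · exact hεD _ (by rw [abs_lt]; constructor <;> linarith [hu.2]) (by linarith)
      · rwa [add_neg_cancel, circleFlow_zero]
      · have := h.2.2 (v - u) (by linarith) (by linarith)
        rwa [neg_sub, sub_eq_add_neg] at this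
  rw [h'.prevMarked_eq, h.prevMarked_eq, circleFlow_add]
  congr 1
  ring

end Topology

/-! ### The strands at a crossing -/

/-- A continuous injective function vanishing at `0` changes sign there. -/
theorem sign_change_of_injOn {h : ℝ → ℝ} {ε : ℝ} (hε : 0 < ε) (h₀ : h 0 = 0)
    (hc : ContinuousOn h (Ioo (-ε) ε)) (hi : InjOn h (Ioo (-ε) ε)) :
    ∃ σ : ℝ, σ ≠ 0 ∧ (∀ᶠ u in 𝓝[>] 0, 0 < σ * h u) ∧ ∀ᶠ u in 𝓝[<] 0, σ * h u < 0 := by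
  have hε' : -ε < ε := by linarith
  have hm : (0 : ℝ) ∈ Ioo (-ε) ε := ⟨by linarith, hε⟩
  rcases hc.strictMonoOn_of_injOn_Ioo hε' hi with hmono | hanti
  · refine ⟨1, one_ne_zero, ?_, ?_⟩
    · filter_upwards [Ioo_mem_nhdsGT hε] with u hu
      rw [one_mul, ← h₀]
      exact hmono hm ⟨by linarith [hu.1], hu.2⟩ hu.1
    · filter_upwards [Ioo_mem_nhdsLT (neg_lt_zero.2 hε)] with u hu
      rw [one_mul, ← h₀]
      exact hmono ⟨hu.1, by linarith [hu.2]⟩ hm hu.2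
  · refine ⟨-1, by norm_num, ?_, ?_⟩
    · filter_upwards [Ioo_mem_nhdsGT hε] with u hu
      have := hanti hm ⟨by linarith [hu.1], hu.2⟩ hu.1
      linarith
    · filter_upwards [Ioo_mem_nhdsLT (neg_lt_zero.2 hε)] with u hu
      have := hanti ⟨hu.1, by linarith [hu.2]⟩ hm hu.2
      linarith

namespace LinkProjection

variable {L : LinkProjection}

/-- The points of the circles that are mapped to crossings. -/
def marked (L : LinkProjection) : Set (Fin L.components × Circle) := L.curve ⁻¹' L.crossings

theorem finite_crossings (L : LinkProjection) : L.crossings.Finite := L.finite_multiple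

theorem crossings_subset_range (L : LinkProjection) : L.crossings ⊆ range L.curve := by
  rintro _ ⟨s, t, -, hs, -⟩
  exact ⟨s, hs⟩

theorem finite_marked (L : LinkProjection) : L.marked.Finite := by
  refine L.finite_crossings.preimage' fun p _ => ?_
  exact Set.finite_of_encard_le_coe (k := 2) (by exact_mod_cast L.fiber_le_two p)

theorem eq_of_curve_eq {x y : Fin L.components × Circle} (hx : x ∉ L.marked)
    (h : L.curve y = L.curve x) : y = x := by
  by_contra hne
  exact hx ⟨y, x, hne, h, rfl⟩

/-- The fibre over a crossing consists of any two different points in it. -/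
theorem eq_or_eq_of_curve_eq {s t x : Fin L.components × Circle} (hst : s ≠ t)
    (ht : L.curve t = L.curve s) (hx : L.curve x = L.curve s) : x = s ∨ x = t := by
  by_contra h
  rw [not_or] at h
  have h3 : ({x, s, t} : Set _).encard = 3 := by
    rw [encard_insert_of_notMem (by simp [h.1, h.2]), encard_pair hst]
    norm_num
  have h4 : ({x, s, t} : Set _) ⊆ L.curve ⁻¹' {L.curve s} := by
    rintro y (rfl | rfl | rfl)
    exacts [hx, rfl, ht]
  have h5 := (encard_le_encard h4).trans (L.fiber_le_two (L.curve s))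
  rw [h3] at h5
  exact absurd h5 (by norm_num)

/-- If near `s` the curve runs in an axis of a chart, then the coordinate along that axis changes
sign at `s`. -/
theorem exists_sign_change {s : Fin L.components × Circle}
    (φ : OpenPartialHomeomorph TwoSphere (ℝ × ℝ)) (hs : L.curve s ∈ φ.source)
    {f k : ℝ × ℝ → ℝ} (hf : Continuous f) (hf₀ : f (φ (L.curve s)) = 0)
    (hfk : ∀ p q, f p = f q → k p = k q → p = q) (hk : ∀ᶠ x in 𝓝 s, k (φ (L.curve x)) = 0) :
    ∃ σ : ℝ, σ ≠ 0 ∧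
      (∀ᶠ u in 𝓝[>] 0, 0 < σ * f (φ (L.curve (circleFlow s u))) ∧
        k (φ (L.curve (circleFlow s u))) = 0) ∧
      (∀ᶠ u in 𝓝[<] 0, σ * f (φ (L.curve (circleFlow s u))) < 0 ∧
        k (φ (L.curve (circleFlow s u))) = 0) := by
  have hcont : Continuous fun u => L.curve (circleFlow s u) :=
    L.curve.continuous.comp (continuous_circleFlow s)
  have hk' : ∀ᶠ u in 𝓝 0, k (φ (L.curve (circleFlow s u))) = 0 := by
    rwa [nhds_eq_map_circleFlow, eventually_map] at hk
  have hsrc : ∀ᶠ u in 𝓝 0, L.curve (circleFlow s u) ∈ φ.source :=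
    hcont.continuousAt.preimage_mem_nhds
      (φ.open_source.mem_nhds (by simpa using hs))
  obtain ⟨ε, hε, h⟩ := Metric.eventually_nhds_iff.1
    ((hk'.and hsrc).and (eventually_circleFlow_notMem L.finite_marked s))
  set δ := min ε Real.pi
  have hδ : 0 < δ := lt_min hε Real.pi_pos
  have h' : ∀ u ∈ Ioo (-δ) δ, (k (φ (L.curve (circleFlow s u))) = 0 ∧
      L.curve (circleFlow s u) ∈ φ.source) ∧ (u ≠ 0 → circleFlow s u ∉ L.marked) := by
    intro u hu
    refine h ?_
    rw [Real.dist_eq, sub_zero]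
    exact (abs_lt.2 hu).trans_le (min_le_left _ _)
  -- on a small interval the curve passes no other multiple point, hence is injective
  have hinj : InjOn (fun u => f (φ (L.curve (circleFlow s u)))) (Ioo (-δ) δ) := by
    intro u hu v hv huv
    have e1 : L.curve (circleFlow s u) = L.curve (circleFlow s v) :=
      φ.injOn (h' u hu).1.2 (h' v hv).1.2
        (hfk _ _ huv ((h' u hu).1.1.trans (h' v hv).1.1.symm))
    have e2 : circleFlow s u = circleFlow s v := by
      by_contra hne
      have h1 : circleFlow s u ∈ L.marked := ⟨_, _, hne, rfl, e1.symm⟩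
      have h2 : circleFlow s v ∈ L.marked := ⟨_, _, hne, e1, rfl⟩
      have h3 : u = 0 := by_contra fun h0 => (h' u hu).2 h0 h1
      have h4 : v = 0 := by_contra fun h0 => (h' v hv).2 h0 h2
      exact hne (by rw [h3, h4])
    have hδpi : δ ≤ Real.pi := min_le_right _ _
    rcases lt_trichotomy u v with hlt | he | hlt
    · refine absurd ?_ (circleFlow_ne_self (x := circleFlow s u) (sub_pos.2 hlt)
        (by linarith [hu.1, hv.2]))
      rw [circleFlow_add, add_sub_cancel, e2]
    · exact he
    · refine absurd ?_ (circleFlow_ne_self (x := circleFlow s v) (sub_pos.2 hlt)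
        (by linarith [hv.1, hu.2]))
      rw [circleFlow_add, add_sub_cancel, e2]
  obtain ⟨σ, hσ, h1, h2⟩ := sign_change_of_injOn hδ
    (h := fun u => f (φ (L.curve (circleFlow s u)))) (by simpa using hf₀)
    (fun u hu => (hf.continuousAt.comp ((φ.continuousAt (h' u hu).1.2).comp
      (f := fun u => L.curve (circleFlow s u)) hcont.continuousAt)).continuousWithinAt) hinj
  exact ⟨σ, hσ, h1.and (nhdsWithin_le_nhds hk'), h2.and (nhdsWithin_le_nhds hk')⟩

/-- The chart `φ` at a crossing is oriented by the strands at `s` and `t`: they run along the first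
and the second axis in the positive direction. -/
structure IsOrientedChart (L : LinkProjection) (φ : OpenPartialHomeomorph TwoSphere (ℝ × ℝ))
    (s t : Fin L.components × Circle) : Prop where
  fst_pos : ∀ᶠ u in 𝓝[>] 0, 0 < (φ (L.curve (circleFlow s u))).1 ∧
    (φ (L.curve (circleFlow s u))).2 = 0
  fst_neg : ∀ᶠ u in 𝓝[<] 0, (φ (L.curve (circleFlow s u))).1 < 0 ∧
    (φ (L.curve (circleFlow s u))).2 = 0
  snd_pos : ∀ᶠ u in 𝓝[>] 0, 0 < (φ (L.curve (circleFlow t u))).2 ∧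
    (φ (L.curve (circleFlow t u))).1 = 0
  snd_neg : ∀ᶠ u in 𝓝[<] 0, (φ (L.curve (circleFlow t u))).2 < 0 ∧
    (φ (L.curve (circleFlow t u))).1 = 0

theorem exists_isOrientedChart {s t : Fin L.components × Circle} (hst : s ≠ t)
    (h : L.curve s = L.curve t) :
    ∃ φ, IsCrossChart (range L.curve) φ (L.curve s) ∧ L.IsOrientedChart φ s t := by
  obtain ⟨φ, hφs, hφ0, hφΓ, hs, ht⟩ := L.transverse s t hst h
  obtain ⟨σ, hσ, s1, s2⟩ := exists_sign_change φ hφs continuous_fst (k := Prod.snd) (by simp [hφ0])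
    (fun p q => Prod.ext) hs
  obtain ⟨τ, hτ, t1, t2⟩ := exists_sign_change φ (h ▸ hφs) continuous_snd (k := Prod.fst)
    (by simp [← h, hφ0]) (fun p q h1 h2 => Prod.ext h2 h1) ht
  refine ⟨φ.transHomeomorph ((Homeomorph.mulLeft₀ σ hσ).prodCongr (Homeomorph.mulLeft₀ τ hτ)),
    ⟨hφs, ?_, fun q hq => ?_⟩, ⟨?_, ?_, ?_, ?_⟩⟩
  · exact Prod.ext (by simp [hφ0]) (by simp [hφ0])
  · simpa [hσ, hτ] using hφΓ q hq
  · simpa [hτ] using s1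
  · simpa [hτ] using s2
  · simpa [hσ] using t1
  · simpa [hσ] using t2

/-- Near a value of the curve, the image consists of the images of small neighbourhoods of the
points of the fibre. -/
theorem eventually_nhds_of_fiber {q : TwoSphere} {Φ : TwoSphere → Prop}
    (h : ∀ x, L.curve x = q → ∀ᶠ y in 𝓝 x, Φ (L.curve y)) :
    ∀ᶠ q' in 𝓝 q, q' ∈ range L.curve → Φ q' := by
  filter_upwards [L.curve.continuous.isClosedMap.eventually_nhds_fiber
    (p := fun y => Φ (L.curve y)) q h] with q' hq'
  rintro ⟨x, rfl⟩
  exact hq' x rfl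

theorem eventually_nhds_crossing {s t : Fin L.components × Circle} (hst : s ≠ t)
    (h : L.curve s = L.curve t) {Φ : TwoSphere → Prop}
    (hs₁ : ∀ᶠ u in 𝓝[>] 0, Φ (L.curve (circleFlow s u)))
    (hs₂ : ∀ᶠ u in 𝓝[<] 0, Φ (L.curve (circleFlow s u)))
    (ht₁ : ∀ᶠ u in 𝓝[>] 0, Φ (L.curve (circleFlow t u)))
    (ht₂ : ∀ᶠ u in 𝓝[<] 0, Φ (L.curve (circleFlow t u))) :
    ∀ᶠ q in 𝓝 (L.curve s), q ∈ range L.curve → q ≠ L.curve s → Φ q := by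
  have key : ∀ x, L.curve x = L.curve s → (∀ᶠ u in 𝓝[>] 0, Φ (L.curve (circleFlow x u))) →
      (∀ᶠ u in 𝓝[<] 0, Φ (L.curve (circleFlow x u))) →
      ∀ᶠ y in 𝓝 x, L.curve y ≠ L.curve s → Φ (L.curve y) := by
    intro x hx h1 h2
    rw [nhds_eq_map_circleFlow, eventually_map]
    have h3 : ∀ᶠ u in 𝓝[≠] 0, Φ (L.curve (circleFlow x u)) := by
      rw [← nhdsLT_sup_nhdsGT, eventually_sup]
      exact ⟨h2, h1⟩
    filter_upwards [eventually_nhdsWithin_iff.1 h3] with u hu hne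
    refine hu fun h0 => hne ?_
    rw [mem_singleton_iff.1 h0, circleFlow_zero, hx]
  refine eventually_nhds_of_fiber fun x hx => ?_
  rcases eq_or_eq_of_curve_eq hst h.symm hx with rfl | rfl
  · exact key _ rfl hs₁ hs₂
  · exact key _ h.symm ht₁ ht₂

end LinkProjection

/-! ### Colourings of the regions and the theorem -/

namespace LinkProjection

variable {L : LinkProjection}

/-- A point of the curve that is not a crossing has a straight chart. -/
theorem exists_isStraightChart {x : Fin L.components × Circle} (hx : x ∉ L.marked) :
    ∃ ψ, IsStraightChart (range L.curve) ψ (L.curve x) :=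
  L.flat x fun _ h => eq_of_curve_eq hx h

/-- Along the circles, the regions on the two sides of the curve are locally constant. -/
theorem eventually_regionsAt_curve_eq {x : Fin L.components × Circle} (hx : x ∉ L.marked) :
    ∀ᶠ y in 𝓝 x, L.regionsAt (L.curve y) = L.regionsAt (L.curve x) := by
  obtain ⟨ψ, hψ⟩ := exists_isStraightChart hx
  filter_upwards [L.curve.continuous.continuousAt.eventually
    (eventually_regionsAt_eq hψ (mem_range_self x))] with y hy
  exact hy (mem_range_self y)

/-- Every crossing `c` has two strands `pt (c, false)` and `pt (c, true)`, which pass it along the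
first and the second axis of the chart `φ c`. -/
structure IsStrandSystem (L : LinkProjection) (pt : L.crossings × Bool → Fin L.components × Circle)
    (φ : L.crossings → OpenPartialHomeomorph TwoSphere (ℝ × ℝ)) : Prop where
  curve_pt : ∀ d, L.curve (pt d) = d.1
  pt_ne : ∀ c, pt (c, false) ≠ pt (c, true)
  isCrossChart : ∀ c : L.crossings, IsCrossChart (range L.curve) (φ c) c
  isOriented : ∀ c, L.IsOrientedChart (φ c) (pt (c, false)) (pt (c, true))

theorem exists_isStrandSystem (L : LinkProjection) : ∃ pt φ, L.IsStrandSystem pt φ := by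
  have h : ∀ c : L.crossings, ∃ (p : Bool → Fin L.components × Circle)
      (φ : OpenPartialHomeomorph TwoSphere (ℝ × ℝ)), (∀ b, L.curve (p b) = c) ∧
        p false ≠ p true ∧ IsCrossChart (range L.curve) φ c ∧
        L.IsOrientedChart φ (p false) (p true) := by
    rintro ⟨c, s, t, hst, hs, ht⟩
    obtain ⟨φ, h1, h2⟩ := exists_isOrientedChart hst (hs.trans ht.symm)
    refine ⟨fun b => if b then t else s, φ, ?_, hst, hs ▸ h1, h2⟩
    rintro (_ | _)
    · exact hs
    · exact ht
  choose p φ h1 h2 h3 h4 using h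
  exact ⟨fun d => p d.1 d.2, φ, fun d => h1 d.1 d.2, h2, h3, h4⟩

section Strands

variable {pt : L.crossings × Bool → Fin L.components × Circle}
  {φ : L.crossings → OpenPartialHomeomorph TwoSphere (ℝ × ℝ)}

theorem IsStrandSystem.injective (h : L.IsStrandSystem pt φ) : Function.Injective pt := by
  rintro ⟨c, b⟩ ⟨c', b'⟩ he
  obtain rfl : c = c' := Subtype.ext ((h.curve_pt (c, b)).symm.trans
    ((congrArg L.curve he).trans (h.curve_pt (c', b'))))
  have := h.pt_ne c
  cases b <;> cases b' <;> simp_all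

theorem IsStrandSystem.mem_marked (h : L.IsStrandSystem pt φ) (d : L.crossings × Bool) :
    pt d ∈ L.marked := by
  rw [marked, mem_preimage, h.curve_pt]
  exact d.1.2

theorem IsStrandSystem.exists_eq (h : L.IsStrandSystem pt φ) {x : Fin L.components × Circle}
    (hx : x ∈ L.marked) : ∃ d, pt d = x := by
  have h1 := h.curve_pt (⟨L.curve x, hx⟩, false)
  have h2 := h.curve_pt (⟨L.curve x, hx⟩, true)
  rcases eq_or_eq_of_curve_eq (h.pt_ne ⟨L.curve x, hx⟩) (h2.trans h1.symm) h1.symm with he | he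
  · exact ⟨_, he.symm⟩
  · exact ⟨_, he.symm⟩

theorem IsStrandSystem.exists_isBackTime (h : L.IsStrandSystem pt φ) (d : L.crossings × Bool) :
    ∃ τ, IsBackTime L.marked (pt d) τ :=
  _root_.exists_isBackTime L.finite_marked (h.mem_marked d) rfl

/-- The strands are permuted by passing to the preceding one on the same circle. -/
theorem IsStrandSystem.exists_prev (h : L.IsStrandSystem pt φ) :
    ∃ P : L.crossings × Bool → L.crossings × Bool, Function.Injective P ∧
      ∀ d, pt (P d) = prevMarked L.marked (pt d) := by
  have : ∀ d, ∃ d', pt d' = prevMarked L.marked (pt d) := by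
    intro d
    obtain ⟨τ, hτ⟩ := h.exists_isBackTime d
    refine h.exists_eq ?_
    rw [hτ.prevMarked_eq]
    exact hτ.2.1
  choose P hP using this
  refine ⟨P, fun d d' he => h.injective ?_, hP⟩
  obtain ⟨τ, hτ⟩ := h.exists_isBackTime d
  obtain ⟨τ', hτ'⟩ := h.exists_isBackTime d'
  refine hτ.eq_of_prevMarked_eq (h.mem_marked d) (h.mem_marked d') hτ' ?_
  rw [← hP, ← hP, he]

/-- Values prescribed on the arcs, each named after its initial strand, come from a function on the
curve that is locally constant away from the crossings. -/
theorem IsStrandSystem.exists_arc_function (h : L.IsStrandSystem pt φ)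
    (f : L.crossings × Bool → ZMod 2) :
    ∃ z : TwoSphere → ZMod 2,
      (∀ x ∉ L.marked, ∀ᶠ y in 𝓝 x, z (L.curve y) = z (L.curve x)) ∧
      (∀ d, ∀ᶠ u in 𝓝[>] 0, z (L.curve (circleFlow (pt d) u)) = f d) ∧
      ∀ d d', pt d' = prevMarked L.marked (pt d) →
        ∀ᶠ u in 𝓝[<] 0, z (L.curve (circleFlow (pt d) u)) = f d' := by
  classical
  -- on circles without crossings this is `0`, because then `x` is its own predecessor
  let F : Fin L.components × Circle → ZMod 2 := fun x =>
    Function.extend pt f 0 (prevMarked L.marked x)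
  let z : TwoSphere → ZMod 2 := fun q => if hq : ∃ x, L.curve x = q then F hq.choose else 0
  have hz : ∀ x ∉ L.marked, z (L.curve x) = F x := by
    intro x hx
    have hq : ∃ y, L.curve y = L.curve x := ⟨x, rfl⟩
    have : z (L.curve x) = F hq.choose := dif_pos hq
    rw [this, eq_of_curve_eq hx hq.choose_spec]
  have hF : ∀ d, ∀ x, prevMarked L.marked x = pt d → F x = f d := fun d x hx => by
    simp only [F, hx]
    exact h.injective.extend_apply f 0 d
  have hnear : ∀ x, ∀ᶠ u in 𝓝[≠] 0, circleFlow x u ∉ L.marked := fun x =>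
    eventually_nhdsWithin_iff.2 (eventually_circleFlow_notMem L.finite_marked x)
  have hgt : 𝓝[>] (0 : ℝ) ≤ 𝓝[≠] 0 := nhdsWithin_mono _ fun u hu => (mem_Ioi.1 hu).ne'
  have hlt : 𝓝[<] (0 : ℝ) ≤ 𝓝[≠] 0 := nhdsWithin_mono _ fun u hu => (mem_Iio.1 hu).ne
  refine ⟨z, fun x hx => ?_, fun d => ?_, fun d d' hd => ?_⟩
  · have hFx : ∀ᶠ y in 𝓝 x, F y = F x := by
      by_cases hτ : ∃ τ, IsBackTime L.marked x τ
      · obtain ⟨τ, hτ⟩ := hτ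
        filter_upwards [hτ.eventually_prevMarked_eq L.finite_marked hx] with y hy
        simp only [F, hy]
      · have hF0 : ∀ y, y.1 = x.1 → y ∉ L.marked → F y = 0 := by
          intro y hyx hy
          have hτy : ¬ ∃ τ, IsBackTime L.marked y τ := by
            rintro ⟨τ, hτy⟩
            exact hτ (_root_.exists_isBackTime L.finite_marked hτy.2.1 hyx.symm)
          have : prevMarked L.marked y = y := dif_neg hτy
          simp only [F, this]
          refine Function.extend_apply' _ _ _ ?_
          rintro ⟨d, rfl⟩
          exact hy (h.mem_marked d)
        have h1 : ∀ᶠ y in 𝓝 x, y.1 = x.1 :=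
          continuous_fst.continuousAt.eventually_mem (isOpen_discrete {x.1} |>.mem_nhds rfl)
        filter_upwards [h1, L.finite_marked.isClosed.isOpen_compl.mem_nhds hx] with y hy hy'
        rw [hF0 y hy hy', hF0 x rfl hx]
    filter_upwards [hFx, L.finite_marked.isClosed.isOpen_compl.mem_nhds hx] with y hy hy'
    rw [hz y hy', hz x hx, hy]
  · filter_upwards [eventually_prevMarked_eq_self L.finite_marked (h.mem_marked d),
      hgt (hnear (pt d))] with u hu hu'
    rw [hz _ hu', hF d _ hu]
  · obtain ⟨τ, hτ⟩ := h.exists_isBackTime d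
    filter_upwards [hτ.eventually_prevMarked_eq_left, hlt (hnear (pt d))] with u hu hu'
    rw [hz _ hu', hF d' _ (hu.trans hd.symm)]

/-- Jumps prescribed on the arcs, with sum zero around every crossing, are realised by a
two-colouring of the regions. -/
theorem IsStrandSystem.exists_coloring (h : L.IsStrandSystem pt φ)
    {P : L.crossings × Bool → L.crossings × Bool}
    (hP : ∀ d, pt (P d) = prevMarked L.marked (pt d))
    {r : L.crossings → Bool → Bool → Set TwoSphere} (hr : ∀ c, L.IsCornerFamily (φ c) c (r c))
    (f : L.crossings × Bool → ZMod 2)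
    (hf : ∀ c, f (c, false) + f (P (c, false)) + f (c, true) + f (P (c, true)) = 0) :
    ∃ w : Set TwoSphere → ZMod 2, ∀ c,
      w (r c true true) + w (r c true false) = f (c, false) ∧
      w (r c false true) + w (r c false false) = f (P (c, false)) ∧
      w (r c true true) + w (r c false true) = f (c, true) ∧
      w (r c true false) + w (r c false false) = f (P (c, true)) := by
  classical
  obtain ⟨z, hz, hz₁, hz₂⟩ := h.exists_arc_function f
  rcases isEmpty_or_nonempty L.crossings with hE | ⟨⟨c₀⟩⟩
  · exact ⟨0, fun c => (hE.false c).elim⟩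
  let lift : TwoSphere → L.crossings := fun q => if hq : q ∈ L.crossings then ⟨q, hq⟩ else c₀
  have hlift : ∀ c : L.crossings, lift c = c := fun c => dif_pos c.2
  obtain ⟨g, hg, hgC⟩ : ∃ g : TwoSphere → ZMod 2,
      (∀ x ∉ range L.curve, ∀ᶠ q in 𝓝 x, g q = g x) ∧
      ∀ c ∈ L.crossings, AgreesNear (range L.curve) g
        (fun q => cornerModel (f (lift c, false)) (f (P (lift c, false))) (f (P (lift c, true)))
          (posInd (φ (lift c) q).1) (posInd (φ (lift c) q).2)) c := by
    refine exists_locally_constant_with_jumps L.isClosed_range_curve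
      L.crossings_subset_range z ?_ ?_ (fun q => φ (lift q)) ?_
      (fun q => f (lift q, false)) (fun q => f (P (lift q, false)))
      (fun q => f (lift q, true)) (fun q => f (P (lift q, true))) ?_ ?_
    · rintro _ ⟨x, rfl⟩ hx
      exact exists_isStraightChart hx
    · rintro _ ⟨x, rfl⟩ hx
      have hx' : x ∉ L.marked := hx
      refine eventually_nhds_of_fiber fun y hy => ?_
      rw [eq_of_curve_eq hx' hy]
      filter_upwards [hz x hx', L.finite_marked.isClosed.isOpen_compl.mem_nhds hx'] with y' h1 h2
      exact ⟨h2, h1⟩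
    · intro q hq
      rw [show lift q = ⟨q, hq⟩ from hlift ⟨q, hq⟩]
      exact h.isCrossChart ⟨q, hq⟩
    · exact fun q _ => hf _
    · intro q hq
      obtain ⟨c, rfl⟩ : ∃ c : L.crossings, (c : TwoSphere) = q := ⟨⟨q, hq⟩, rfl⟩
      simp only [hlift]
      have hs := h.curve_pt (c, false)
      have ht := h.curve_pt (c, true)
      have ho := h.isOriented c
      have hnear : ∀ x, ∀ᶠ u in 𝓝[≠] 0, circleFlow x u ∉ L.marked := fun x =>
        eventually_nhdsWithin_iff.2 (eventually_circleFlow_notMem L.finite_marked x)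
      have hgt : 𝓝[>] (0 : ℝ) ≤ 𝓝[≠] 0 := nhdsWithin_mono _ fun u hu => (mem_Ioi.1 hu).ne'
      have hlt : 𝓝[<] (0 : ℝ) ≤ 𝓝[≠] 0 := nhdsWithin_mono _ fun u hu => (mem_Iio.1 hu).ne
      have := eventually_nhds_crossing (h.pt_ne c) (hs.trans ht.symm) (Φ := fun q => q ∉ L.crossings ∧
        (0 < (φ c q).1 → z q = f (c, false)) ∧ ((φ c q).1 < 0 → z q = f (P (c, false))) ∧
        (0 < (φ c q).2 → z q = f (c, true)) ∧ ((φ c q).2 < 0 → z q = f (P (c, true)))) ?_ ?_ ?_ ?_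
      · rw [hs] at this
        exact this
      · filter_upwards [ho.fst_pos, hz₁ (c, false), hgt (hnear _)] with u hu h1 h2
        exact ⟨h2, fun _ => h1, fun h => absurd hu.1 h.not_gt, fun h => absurd hu.2 h.ne',
          fun h => absurd hu.2 h.ne⟩
      · filter_upwards [ho.fst_neg, hz₂ (c, false) _ (hP _), hlt (hnear _)] with u hu h1 h2
        exact ⟨h2, fun h => absurd hu.1 h.not_gt, fun _ => h1, fun h => absurd hu.2 h.ne',
          fun h => absurd hu.2 h.ne⟩
      · filter_upwards [ho.snd_pos, hz₁ (c, true), hgt (hnear _)] with u hu h1 h2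
        exact ⟨h2, fun h => absurd hu.2 h.ne', fun h => absurd hu.2 h.ne, fun _ => h1,
          fun h => absurd hu.1 h.not_gt⟩
      · filter_upwards [ho.snd_neg, hz₂ (c, true) _ (hP _), hlt (hnear _)] with u hu h1 h2
        exact ⟨h2, fun h => absurd hu.2 h.ne', fun h => absurd hu.2 h.ne,
          fun h => absurd hu.1 h.not_gt, fun _ => h1⟩
  obtain ⟨w, hw⟩ := exists_region_coloring hg
  refine ⟨w, fun c => ?_⟩
  have hgc := hgC c c.2
  simp only [hlift] at hgc
  obtain ⟨k, hk⟩ := (hr c).coloring_eq (h.isCrossChart c) hw hgc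
  have hs := hf c
  simp only [hk]
  generalize f (c, false) = a, f (P (c, false)) = a', f (c, true) = b, f (P (c, true)) = b' at hs
  clear hk hgc
  revert a a' b b' k
  decide

/-- The regions along the arc that ends at a strand are those along the arc that starts at the
preceding strand. -/
theorem IsStrandSystem.regions_along_arc (h : L.IsStrandSystem pt φ)
    {P : L.crossings × Bool → L.crossings × Bool}
    (hP : ∀ d, pt (P d) = prevMarked L.marked (pt d))
    {r : L.crossings → Bool → Bool → Set TwoSphere} (hr : ∀ c, L.IsCornerFamily (φ c) c (r c)) :
    ∃ A : L.crossings × Bool → Set (Set TwoSphere), ∀ c,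
      A (c, false) = {r c true true, r c true false} ∧
      A (P (c, false)) = {r c false true, r c false false} ∧
      A (c, true) = {r c true true, r c false true} ∧
      A (P (c, true)) = {r c true false, r c false false} := by
  let A : L.crossings × Bool → Set (Set TwoSphere) := fun d =>
    if d.2 then {r d.1 true true, r d.1 false true} else {r d.1 true true, r d.1 true false}
  let B : L.crossings × Bool → Set (Set TwoSphere) := fun d =>
    if d.2 then {r d.1 true false, r d.1 false false} else {r d.1 false true, r d.1 false false}
  have hcorner : ∀ d, ∀ᶠ u in 𝓝 0,
      (∀ a, (φ d.1 (L.curve (circleFlow (pt d) u))).1 ∈ openHalfLine a →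
        (φ d.1 (L.curve (circleFlow (pt d) u))).2 = 0 →
        L.regionsAt (L.curve (circleFlow (pt d) u)) = {r d.1 a true, r d.1 a false}) ∧
      (∀ b, (φ d.1 (L.curve (circleFlow (pt d) u))).2 ∈ openHalfLine b →
        (φ d.1 (L.curve (circleFlow (pt d) u))).1 = 0 →
        L.regionsAt (L.curve (circleFlow (pt d) u)) = {r d.1 true b, r d.1 false b}) := by
    intro d
    have ht : Tendsto (fun u => L.curve (circleFlow (pt d) u)) (𝓝 0) (𝓝 (d.1 : TwoSphere)) := by
      have := (L.curve.continuous.comp (continuous_circleFlow (pt d))).tendsto 0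
      rwa [Function.comp_apply, circleFlow_zero, h.curve_pt] at this
    exact ht.eventually ((hr d.1).eventually_regionsAt_eq (h.isCrossChart d.1))
  have hA : ∀ d, ∀ᶠ u in 𝓝[>] 0, L.regionsAt (L.curve (circleFlow (pt d) u)) = A d := by
    rintro ⟨c, _ | _⟩
    · filter_upwards [nhdsWithin_le_nhds (hcorner (c, false)), (h.isOriented c).fst_pos] with
        u h1 h2
      exact h1.1 true h2.1 h2.2
    · filter_upwards [nhdsWithin_le_nhds (hcorner (c, true)), (h.isOriented c).snd_pos] with
        u h1 h2
      exact h1.2 true h2.1 h2.2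
  have hB : ∀ d, ∀ᶠ u in 𝓝[<] 0, L.regionsAt (L.curve (circleFlow (pt d) u)) = B d := by
    rintro ⟨c, _ | _⟩
    · filter_upwards [nhdsWithin_le_nhds (hcorner (c, false)), (h.isOriented c).fst_neg] with
        u h1 h2
      exact h1.1 false h2.1 h2.2
    · filter_upwards [nhdsWithin_le_nhds (hcorner (c, true)), (h.isOriented c).snd_neg] with
        u h1 h2
      exact h1.2 false h2.1 h2.2
  have hAB : ∀ d, A (P d) = B d := by
    intro d
    obtain ⟨τ, hτ⟩ := h.exists_isBackTime d
    exact hτ.eq_along_arc (F := fun x => L.regionsAt (L.curve x))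
      (fun y hy => eventually_regionsAt_curve_eq hy) (hP d ▸ hA (P d)) (hB d)
  exact ⟨A, fun c => ⟨rfl, hAB (c, false), rfl, hAB (c, true)⟩⟩

end Strands

/-- If there are at least four crossings, then some two regions do not share a crossing. -/
theorem exists_regions_not_connected (hL : 4 ≤ L.crossings.encard) :
    ∃ R ∈ L.regions, ∃ S ∈ L.regions, R ≠ S ∧ ¬ L.RegionsConnected R S := by
  by_contra! hall
  obtain ⟨pt, φ, h⟩ := L.exists_isStrandSystem
  obtain ⟨P, hPi, hP⟩ := h.exists_prev
  have hfam := fun c => exists_isCornerFamily (h.isCrossChart c)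
  choose r hr using hfam
  obtain ⟨A, hA⟩ := h.regions_along_arc hP hr
  have := L.finite_crossings.fintype
  have hcard : 4 ≤ Fintype.card L.crossings := by
    rw [← Set.coe_fintypeCard] at hL
    exact_mod_cast hL
  obtain ⟨c₀⟩ : Nonempty L.crossings := Fintype.card_pos_iff.1 (by omega)
  let r' : L.crossings → Bool → Bool → L.regions := fun c a b => ⟨r c a b, (hr c).1 a b⟩
  have hshare : ∀ R₁ R₂ : L.regions, R₁ ≠ R₂ →
      ∃ c a b a' b', R₁ = r' c a b ∧ R₂ = r' c a' b' := by
    intro R₁ R₂ hne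
    obtain ⟨c, hc, h1, h2⟩ := hall R₁ R₁.2 R₂ R₂.2 fun he => hne (Subtype.ext he)
    obtain ⟨a, b, hab⟩ := (hr ⟨c, hc⟩).eq_of_mem_closure (h.isCrossChart ⟨c, hc⟩) R₁.2
      (frontier_subset_closure h1)
    obtain ⟨a', b', hab'⟩ := (hr ⟨c, hc⟩).eq_of_mem_closure (h.isCrossChart ⟨c, hc⟩) R₂.2
      (frontier_subset_closure h2)
    exact ⟨⟨c, hc⟩, a, b, a', b', Subtype.ext hab, Subtype.ext hab'⟩
  -- every region other than `r' c₀ true true` shares a crossing with it, so it is a corner region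
  have hfin : Finite L.regions := by
    refine Finite.of_surjective (fun x : L.crossings × Bool × Bool => r' x.1 x.2.1 x.2.2) ?_
    intro R
    by_cases hR : R = r' c₀ true true
    · exact ⟨(c₀, true, true), hR.symm⟩
    · obtain ⟨c, a, b, -, -, hab, -⟩ := hshare R _ hR
      exact ⟨(c, a, b), hab.symm⟩
  have := Fintype.ofFinite L.regions
  have hpair : ∀ R S : L.regions, (Subtype.val ⁻¹' {R.1, S.1} : Set L.regions) = {R, S} := by
    intro R S
    ext T
    simp [Subtype.ext_iff]
  refine no_four_crossings_of_pairwise_connected hcard P hPi r' (fun d => Subtype.val ⁻¹' A d)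
    ?_ ?_ ?_ ?_ ?_ hshare
  · intro c
    rw [(hA c).1]
    exact hpair (r' c _ _) (r' c _ _)
  · intro c
    rw [(hA c).2.1]
    exact hpair (r' c _ _) (r' c _ _)
  · intro c
    rw [(hA c).2.2.1]
    exact hpair (r' c _ _) (r' c _ _)
  · intro c
    rw [(hA c).2.2.2]
    exact hpair (r' c _ _) (r' c _ _)
  · intro f hf
    obtain ⟨w, hw⟩ := h.exists_coloring hP hr f hf
    exact ⟨fun R => w R.1, hw⟩

theorem RegionsConnected.symm {R S : Set TwoSphere} (h : L.RegionsConnected R S) :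
    L.RegionsConnected S R :=
  h.imp fun _ hc => ⟨hc.1, hc.2.2, hc.2.1⟩

end LinkProjection

theorem mainTheorem3 (L : LinkProjection) (hL : 4 ≤ L.crossings.encard) :
    2 ≤ L.isolateRegionNumber := by
  obtain ⟨R, hR, S, hS, hne, hRS⟩ := LinkProjection.exists_regions_not_connected hL
  have hW : L.IsIsolated {R, S} := by
    refine ⟨pair_subset hR hS, ?_⟩
    rintro T (rfl | rfl) T' (rfl | rfl) hTT'
    · exact absurd rfl hTT'
    · exact hRS
    · exact fun h => hRS h.symm
    · exact absurd rfl hTT'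
  rw [← encard_pair hne]
  exact le_iSup₂ (f := fun W (_ : W ∈ {W | L.IsIsolated W}) => W.encard) {R, S} hW
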